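/- Let $L$ be a finite relational language and let $\alpha=(\alpha_R)_R$ be a family of real numbers, indexed by the relation symbols $R$ of $L$, with $0<\alpha_R\le 1$. Consider only $L$-structures in which every relation is symmetric (invariant under permutations of its arguments) and irreflexive (it holds only for sequences of distinct elements), so that relations are relations on sets. For a finite $L$-structure $A$ put $$\delta_\alpha(A)=|A|-\sum_R \alpha_R\, w_R(A),$$ where $w_R(A)$ is the number of subsets of $A$ of which $R$ holds. Let $\mathbf K_\alpha$ be the class of finite structures $A$ (including the empty one) such that $\delta_\alpha(A')\ge 0$ for every substructure $A'\subseteq A$, and let $\mathbf K$ be the class of structures all of whose finite substructures lie in $\mathbf K_\alpha$. For $N\in\mathbf K$ and finite $X\subseteq N$ put $d_N(X)=\inf\{\delta_\alpha(B): X\subseteq B\subseteq N,\ B\text{ finite}\}$; for $M\subseteq N$ in $\mathbf K$ write $M\le_s N$ if $d_M(X)=d_N(X)$ for every finite $X\subseteq M$. A countable $M\in\mathbf K$ is $(\mathbf K_\alpha,\le_s)$-generic if (i) whenever $A\le_s M$ and $A\le_s B$ with $A,B\in\mathbf K_\alpha$, there is $B'\le_s M$ with $B'\cong_A B$; and (ii)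 $M=\bigcup_{i<\omega}A_i$ for some $A_i\in\mathbf K_\alpha$ with $A_i\le_s A_{i+1}$ for all $i$. Then a $(\mathbf K_\alpha,\le_s)$-generic model $M_\alpha$ exists, and its complete first-order theory $T_\alpha=\mathrm{Th}(M_\alpha)$ is nearly model complete: for every $L$-formula $\varphi(\bar x)$ there is a Boolean combination $\psi(\bar x)$ of $\Sigma_1$-formulas (formulas $\exists\bar y\,\theta(\bar x,\bar y)$ with $\theta$ quantifier-free) such that $T_\alpha\vdash\forall\bar x\,(\varphi(\bar x)\leftrightarrow\psi(\bar x))$. This holds for every generic model $M_\alpha$. -/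

import Mathlib

open FirstOrder

universe u v w w'

namespace BaldwinShelah

section Dimension

variable {L : FirstOrder.Language.{u, v}}

/-- Every relation of `M` is symmetric (invariant under permutations of its arguments) and
irreflexive (it holds only for sequences of pairwise distinct elements). -/
def SymmIrrefl (L : FirstOrder.Language.{u, v}) (M : Type w) [L.Structure M] : Prop :=
  ∀ (n : ℕ) (R : L.Relations n) (x : Fin n → M), FirstOrder.Language.Structure.RelMap R x →
    Function.Injective x ∧ ∀ σ : Equiv.Perm (Fin n), FirstOrder.Language.Structure.RelMap R (x ∘ σ)

/-- The number of subsets `S` of the finite set `A` such that `R` holds of an enumeration of `S`: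
the number of realizations of `R`, regarded as a relation on sets, in the substructure of `M` with
universe `A`. -/
noncomputable def weight {M : Type w} [L.Structure M] {n : ℕ} (R : L.Relations n)
    (A : Finset M) : ℕ :=
  Set.ncard {S : Finset M | S ⊆ A ∧
    ∃ x : Fin n → M, Set.range x = (S : Set M) ∧ FirstOrder.Language.Structure.RelMap R x}

variable [Fintype (Σ n, L.Relations n)] (α : (Σ n, L.Relations n) → ℝ)

/-- The predimension `δ_α(A) = |A| - ∑_R α_R w_R(A)` of the (induced structure on the) finite
subset `A` of `M`. -/
noncomputable def predim {M : Type w} [L.Structure M] (A : Finset M) : ℝ :=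
  (A.card : ℝ) - ∑ R : (Σ n, L.Relations n), α R * (weight R.2 A : ℝ)

/-- The class of all structures, finite or not, all of whose finite substructures lie in
`K_α`. The finite members of this class are exactly the members of `K_α`. -/
def InK (M : Type w) [L.Structure M] : Prop :=
  SymmIrrefl L M ∧ ∀ A : Finset M, 0 ≤ predim α A

/-- The class `K_α` of finite structures. -/
def InK0 (A : Type w) [L.Structure A] : Prop :=
  Finite A ∧ InK α A

/-- `d_S(X) = inf {δ_α(B) : X ⊆ B ⊆ S, B finite}` for the substructure of `M` with universe `S`
and a finite subset `X` of `S`. -/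
noncomputable def dimIn {M : Type w} [L.Structure M] (S : Set M) (X : Finset M) : ℝ :=
  sInf {r : ℝ | ∃ B : Finset M, X ⊆ B ∧ (B : Set M) ⊆ S ∧ r = predim α B}

/-- `S ≤_s T` for the substructures of `M` with universes `S` and `T`. -/
def Strong {M : Type w} [L.Structure M] (S T : Set M) : Prop :=
  S ⊆ T ∧ ∀ X : Finset M, (X : Set M) ⊆ S → dimIn α S X = dimIn α T X

/-- The embedding `f` is strong: its image is a strong substructure of its target. -/
def StrongEmb {A : Type w} {M : Type w'} [L.Structure A] [L.Structure M] (f : A ↪[L] M) : Prop :=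
  Strong α (Set.range f) Set.univ

/-- `M` is a `(K_α, ≤_s)`-generic model. -/
structure IsGeneric (M : Type w) [L.Structure M] : Prop where
  countable : Countable M
  inK : InK α M
  /-- If `A ≤_s M` and `A ≤_s B` with `A` and `B` in `K_α`, then `B` has a copy over `A` which is
  strong in `M`. -/
  extension : ∀ (A B : Type) [L.Structure A] [L.Structure B], InK0 α A → InK0 α B →
    ∀ (f : A ↪[L] M) (h : A ↪[L] B), StrongEmb α f → StrongEmb α h →
      ∃ g : B ↪[L] M, StrongEmb α g ∧ ∀ a : A, g (h a) = f a
  /-- `M` is the union of a chain of finite substructures, each strong in the next. -/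
  chain : ∃ A : ℕ → Finset M, (∀ i, Strong α (A i : Set M) (A (i + 1) : Set M)) ∧
    ⋃ i, (A i : Set M) = Set.univ

end Dimension

section NearModelCompleteness

/-- A `Σ₁`-formula: a block of existential quantifiers in front of a quantifier-free formula. -/
def IsSigmaOne {L : FirstOrder.Language.{u, v}} {β : Type w} (φ : L.Formula β) : Prop :=
  ∃ (k : ℕ) (θ : L.BoundedFormula β k), θ.IsQF ∧ φ = θ.exs

/-- Boolean combinations of `Σ₁`-formulas. -/
inductive IsBoolCombSigmaOne {L : FirstOrder.Language.{u, v}} {β : Type w} : L.Formula β → Prop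
  | sigmaOne {φ : L.Formula β} : IsSigmaOne φ → IsBoolCombSigmaOne φ
  | not {φ : L.Formula β} : IsBoolCombSigmaOne φ → IsBoolCombSigmaOne φ.not
  | inf {φ ψ : L.Formula β} :
      IsBoolCombSigmaOne φ → IsBoolCombSigmaOne ψ → IsBoolCombSigmaOne (φ ⊓ ψ)
  | sup {φ ψ : L.Formula β} :
      IsBoolCombSigmaOne φ → IsBoolCombSigmaOne ψ → IsBoolCombSigmaOne (φ ⊔ ψ)

/-- Every formula is equivalent in `T` to a Boolean combination of `Σ₁`-formulas in the same free
variables. -/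
def NearlyModelComplete {L : FirstOrder.Language.{u, v}} (T : L.Theory) : Prop :=
  ∀ (n : ℕ) (φ : L.Formula (Fin n)), ∃ ψ : L.Formula (Fin n), IsBoolCombSigmaOne ψ ∧ φ ⇔[T] ψ

end NearModelCompleteness

end BaldwinShelah

/-! Near model completeness is a back-and-forth argument inside the generic model `M`. Two tuples
count as equivalent at level `k` when the same quantifier-free types of `k`-tuples are realized over
both. By `exists_lookahead`, for every `m` some `k` is such that, if `a` and `a'` are equivalent at
level `k`, every `b` has a `b'` with `ab` and `a'b'` equivalent at level `m`. Induction on formulas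
then makes each formula invariant at some level (`exists_invariant`). As the language is finite, a
level has finitely many classes, each cut out by `Σ₁`-formulas and their negations
(`boolSigmaOneDefinable_of_invariant`).

The lookahead rests on three facts. Adding at most `m` points lowers the predimension either not at
all or by at least some fixed `ε > 0` (`exists_delta_gap`); as predimensions are nonnegative, a
bounded descent enlarges any finite set to one that is strong up to `m`. Secondly, genericity
realizes a strong extension freely over any strong finite set containing its base
(`exists_free_extension`), so a set that is strong up to `m` controls the level-`m` type of its
tuples. Thirdly, strength up to `m` passes from the base to the free factor (`strongUpTo_of_free`).
Thus `a` is enclosed in a set `A` that is strong up to a large `p`, `A` is copied over `a'`, and a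
bounded extension `B` of `A` containing `b` is realized freely over the copy.

Existence is a Fraïssé construction: free amalgams over strong bases stay in the class, and
countably many extension requirements are met along a strong chain. -/

namespace BaldwinShelah

open FirstOrder.Language

/-! ### Predimension, submodularity and strong sets in coloured hypergraphs. -/

section Hypergraph

variable {ι : Type*} {V W : Type*}

/-- The number of hyperedges of colour `R` inside `A`. -/
noncomputable def edgeCount (H : ι → Set (Finset V)) (R : ι) (A : Finset V) : ℕ :=
  Set.ncard {S : Finset V | S ⊆ A ∧ S ∈ H R}

lemma finite_edges_inside (H : ι → Set (Finset V)) (R : ι) (A : Finset V) :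
    {S : Finset V | S ⊆ A ∧ S ∈ H R}.Finite :=
  A.powerset.finite_toSet.subset fun S hS => by simpa using hS.1

lemma edgeCount_mono (H : ι → Set (Finset V)) (R : ι) {A B : Finset V} (h : A ⊆ B) :
    edgeCount H R A ≤ edgeCount H R B :=
  Set.ncard_le_ncard (fun _ hS => ⟨hS.1.trans h, hS.2⟩) (finite_edges_inside H R B)

lemma edgeCount_congr {H H' : ι → Set (Finset V)} {R : ι} {A B : Finset V}
    (h : ∀ S, (S ⊆ A ∧ S ∈ H R) ↔ (S ⊆ B ∧ S ∈ H' R)) : edgeCount H R A = edgeCount H' R B := by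
  unfold edgeCount
  congr 1
  ext S
  exact h S

/-- `H` on subsets of `B` is carried by `g` isomorphically onto `H'` on subsets of `g '' B`. -/
def PartialIso [DecidableEq W] (H : ι → Set (Finset V)) (H' : ι → Set (Finset W)) (g : V → W)
    (B : Finset V) : Prop :=
  Set.InjOn g B ∧ ∀ R, ∀ S ⊆ B, S ∈ H R ↔ S.image g ∈ H' R

lemma PartialIso.mono [DecidableEq W] {H : ι → Set (Finset V)} {H' : ι → Set (Finset W)}
    {g : V → W} {A B : Finset V} (h : PartialIso H H' g B) (hAB : A ⊆ B) :
    PartialIso H H' g A :=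
  ⟨h.1.mono (by exact_mod_cast hAB), fun R S hS => h.2 R S (hS.trans hAB)⟩

lemma PartialIso.comp [DecidableEq W] {X : Type*} [DecidableEq X] {H : ι → Set (Finset V)}
    {H' : ι → Set (Finset W)} {H'' : ι → Set (Finset X)} {f : V → W} {g : W → X} {B : Finset V}
    (hf : PartialIso H H' f B) (hg : PartialIso H' H'' g (B.image f)) :
    PartialIso H H'' (g ∘ f) B := by
  refine ⟨hg.1.comp hf.1 fun x hx => ?_, fun R S hS => ?_⟩
  · exact_mod_cast Finset.mem_image_of_mem f hx
  · rw [hf.2 R S hS, hg.2 R _ (Finset.image_subset_image hS), Finset.image_image]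

lemma PartialIso.invFunOn [DecidableEq V] [DecidableEq W] [Nonempty V] {H : ι → Set (Finset V)}
    {H' : ι → Set (Finset W)} {g : V → W} {B : Finset V} (h : PartialIso H H' g B) :
    PartialIso H' H (Function.invFunOn g B) (B.image g) := by
  have hinv : ∀ x ∈ B, Function.invFunOn g B (g x) = x := fun x hx =>
    h.1.leftInvOn_invFunOn (Finset.mem_coe.2 hx)
  refine ⟨?_, fun R S hS => ?_⟩
  · intro x hx y hy hxy
    obtain ⟨x, hx', rfl⟩ := Finset.mem_image.1 (Finset.mem_coe.1 hx)
    obtain ⟨y, hy', rfl⟩ := Finset.mem_image.1 (Finset.mem_coe.1 hy)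
    rw [hinv x hx', hinv y hy'] at hxy
    rw [hxy]
  · obtain ⟨T, hT, rfl⟩ := Finset.subset_image_iff.1 hS
    have hT' : T ⊆ B := by exact_mod_cast hT
    rw [← h.2 R T hT', Finset.image_image]
    congr! 1
    conv_lhs => rw [← Finset.image_id (s := T)]
    exact Finset.image_congr fun x hx => (hinv x (hT' hx)).symm

lemma PartialIso.edgeCount_image [DecidableEq W] {H : ι → Set (Finset V)}
    {H' : ι → Set (Finset W)} {g : V → W} {A : Finset V} (h : PartialIso H H' g A) (R : ι) :
    edgeCount H' R (A.image g) = edgeCount H R A := by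
  have himg : {S : Finset W | S ⊆ A.image g ∧ S ∈ H' R} =
      (fun S : Finset V => S.image g) '' {S | S ⊆ A ∧ S ∈ H R} := by
    ext S
    constructor
    · rintro ⟨hS, hR⟩
      obtain ⟨T, hT, rfl⟩ := Finset.subset_image_iff.1 hS
      have hT' : T ⊆ A := by exact_mod_cast hT
      exact ⟨T, ⟨hT', (h.2 R T hT').2 hR⟩, rfl⟩
    · rintro ⟨T, ⟨hT, hR⟩, rfl⟩
      exact ⟨Finset.image_subset_image hT, (h.2 R T hT).1 hR⟩
  unfold edgeCount
  rw [himg, Set.InjOn.ncard_image]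
  rintro S ⟨hS, -⟩ T ⟨hT, -⟩ hST
  have hS' : (S : Set V) ⊆ A := by exact_mod_cast hS
  have hT' : (T : Set V) ⊆ A := by exact_mod_cast hT
  have := congrArg (fun U : Finset W => (U : Set W)) hST
  simp only [Finset.coe_image] at this
  exact_mod_cast (h.1.image_eq_image_iff hS' hT').1 this

variable [Fintype ι] (α : ι → ℝ)

/-- The predimension of a finite set of vertices of a coloured hypergraph. -/
noncomputable def delta (H : ι → Set (Finset V)) (A : Finset V) : ℝ :=
  (A.card : ℝ) - ∑ R, α R * (edgeCount H R A : ℝ)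

variable {α}

lemma PartialIso.delta_image [DecidableEq W] {H : ι → Set (Finset V)}
    {H' : ι → Set (Finset W)} {g : V → W} {A : Finset V} (h : PartialIso H H' g A) :
    delta α H' (A.image g) = delta α H A := by
  unfold delta
  simp only [h.edgeCount_image, Finset.card_image_of_injOn h.1]

lemma delta_congr {H H' : ι → Set (Finset V)} {A : Finset V}
    (h : ∀ R, ∀ S ⊆ A, S ∈ H R ↔ S ∈ H' R) : delta α H A = delta α H' A := by
  unfold delta
  congr! 4 with R
  exact edgeCount_congr fun S => and_congr_right fun hS => h R S hS

lemma delta_le_card (hα : ∀ R, 0 < α R) (H : ι → Set (Finset V)) (A : Finset V) :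
    delta α H A ≤ A.card :=
  sub_le_self _ (Finset.sum_nonneg fun R _ => mul_nonneg (hα R).le (Nat.cast_nonneg _))

/-- Submodularity: cardinality is modular, while an edge inside `A ∪ B` contained in neither `A` nor
`B` is counted only on the left, with a negative sign. -/
lemma delta_union_add_inter_le [DecidableEq V] (hα : ∀ R, 0 < α R) (H : ι → Set (Finset V))
    (A B : Finset V) :
    delta α H (A ∪ B) + delta α H (A ∩ B) ≤ delta α H A + delta α H B := by
  have hcard : ((A ∪ B).card : ℝ) + (A ∩ B).card = A.card + B.card := by
    exact_mod_cast Finset.card_union_add_card_inter A B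
  have hedge : ∀ R, (edgeCount H R A : ℝ) + edgeCount H R B ≤
      edgeCount H R (A ∪ B) + edgeCount H R (A ∩ B) := fun R => by
    have h1 := Set.ncard_union_add_ncard_inter _ _ (finite_edges_inside H R A)
      (finite_edges_inside H R B)
    have h2 : ({S | S ⊆ A ∧ S ∈ H R} ∪ {S | S ⊆ B ∧ S ∈ H R}).ncard ≤ edgeCount H R (A ∪ B) :=
      Set.ncard_le_ncard (by
        rintro S (hS | hS)
        · exact ⟨hS.1.trans Finset.subset_union_left, hS.2⟩
        · exact ⟨hS.1.trans Finset.subset_union_right, hS.2⟩) (finite_edges_inside H R _)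
    have h3 : ({S | S ⊆ A ∧ S ∈ H R} ∩ {S | S ⊆ B ∧ S ∈ H R}).ncard ≤ edgeCount H R (A ∩ B) :=
      Set.ncard_le_ncard (by
        rintro S ⟨hS, hS'⟩
        exact ⟨Finset.subset_inter hS.1 hS'.1, hS.2⟩) (finite_edges_inside H R _)
    have h4 : edgeCount H R A + edgeCount H R B ≤
      edgeCount H R (A ∪ B) + edgeCount H R (A ∩ B) := by unfold edgeCount at *; omega
    exact_mod_cast h4
  have hsum : ∑ R, α R * (edgeCount H R A : ℝ) + ∑ R, α R * (edgeCount H R B : ℝ) ≤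
      ∑ R, α R * (edgeCount H R (A ∪ B) : ℝ) + ∑ R, α R * (edgeCount H R (A ∩ B) : ℝ) := by
    rw [← Finset.sum_add_distrib, ← Finset.sum_add_distrib]
    refine Finset.sum_le_sum fun R _ => ?_
    rw [← mul_add, ← mul_add]
    exact mul_le_mul_of_nonneg_left (hedge R) (hα R).le
  unfold delta
  linarith

/-- Freely joined sets: the predimension is modular. -/
lemma delta_union_add_inter_eq [DecidableEq V] (H : ι → Set (Finset V)) (A B : Finset V)
    (hfree : ∀ R, ∀ S ∈ H R, S ⊆ A ∪ B → S ⊆ A ∨ S ⊆ B) :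
    delta α H (A ∪ B) + delta α H (A ∩ B) = delta α H A + delta α H B := by
  have hcard : ((A ∪ B).card : ℝ) + (A ∩ B).card = A.card + B.card := by
    exact_mod_cast Finset.card_union_add_card_inter A B
  have hedge : ∀ R, (edgeCount H R A : ℝ) + edgeCount H R B =
      edgeCount H R (A ∪ B) + edgeCount H R (A ∩ B) := fun R => by
    have h1 := Set.ncard_union_add_ncard_inter _ _ (finite_edges_inside H R A)
      (finite_edges_inside H R B)
    have h2 : {S | S ⊆ A ∧ S ∈ H R} ∪ {S | S ⊆ B ∧ S ∈ H R} = {S | S ⊆ A ∪ B ∧ S ∈ H R} := by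
      ext S
      constructor
      · rintro (hS | hS)
        · exact ⟨hS.1.trans Finset.subset_union_left, hS.2⟩
        · exact ⟨hS.1.trans Finset.subset_union_right, hS.2⟩
      · rintro ⟨hS, hR⟩
        exact (hfree R S hR hS).imp (fun h => ⟨h, hR⟩) fun h => ⟨h, hR⟩
    have h3 : {S | S ⊆ A ∧ S ∈ H R} ∩ {S | S ⊆ B ∧ S ∈ H R} = {S | S ⊆ A ∩ B ∧ S ∈ H R} := by
      ext S
      simp only [Set.mem_inter_iff, Set.mem_ofPred_eq, Finset.subset_inter_iff]
      tauto
    rw [h2, h3] at h1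
    exact_mod_cast h1.symm
  have hsum : ∑ R, α R * (edgeCount H R A : ℝ) + ∑ R, α R * (edgeCount H R B : ℝ) =
      ∑ R, α R * (edgeCount H R (A ∪ B) : ℝ) + ∑ R, α R * (edgeCount H R (A ∩ B) : ℝ) := by
    simp only [← Finset.sum_add_distrib, ← mul_add, hedge]
  unfold delta
  linarith

/-- Points outside `Q` are isolated, so discarding them loses cardinality but no edge. -/
lemma delta_inter_le_of_edges_subset [DecidableEq V] {H : ι → Set (Finset V)} {Q : Finset V}
    (hQ : ∀ R, ∀ S ∈ H R, S ⊆ Q) (Y : Finset V) : delta α H (Y ∩ Q) ≤ delta α H Y := by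
  unfold delta
  have : ∀ R, edgeCount H R (Y ∩ Q) = edgeCount H R Y := fun R => edgeCount_congr fun S =>
    ⟨fun h => ⟨h.1.trans Finset.inter_subset_left, h.2⟩,
      fun h => ⟨Finset.subset_inter h.1 (hQ R S h.2), h.2⟩⟩
  simp only [this]
  have h : ((Y ∩ Q).card : ℝ) ≤ Y.card := by
    exact_mod_cast Finset.card_le_card Finset.inter_subset_left
  linarith

/-- `A` is strong in every finite superset that is contained in `T`. -/
def StrongIn (α : ι → ℝ) (H : ι → Set (Finset V)) (A : Finset V) (T : Set V) : Prop :=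
  ∀ C : Finset V, A ⊆ C → (C : Set V) ⊆ T → delta α H A ≤ delta α H C

/-- `A` is strong in every superset with at most `m` further elements. -/
def StrongUpTo (α : ι → ℝ) (H : ι → Set (Finset V)) (m : ℕ) (A : Finset V) : Prop :=
  ∀ C : Finset V, A ⊆ C → C.card ≤ A.card + m → delta α H A ≤ delta α H C

/-- Submodularity for `C` and `A`, where strength gives `δ(A) ≤ δ(C ∪ A)`. In this form strength
applies to sets that need not contain `A`. -/
lemma StrongIn.inter_le [DecidableEq V] (hα : ∀ R, 0 < α R) {H : ι → Set (Finset V)}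
    {A : Finset V} {T : Set V} (h : StrongIn α H A T) (hAT : (A : Set V) ⊆ T) {C : Finset V}
    (hC : (C : Set V) ⊆ T) : delta α H (C ∩ A) ≤ delta α H C := by
  have h1 := delta_union_add_inter_le hα H C A
  have h2 := h (C ∪ A) Finset.subset_union_right (by
    rw [Finset.coe_union]
    exact Set.union_subset hC hAT)
  linarith

lemma StrongIn.trans [DecidableEq V] (hα : ∀ R, 0 < α R) {H : ι → Set (Finset V)}
    {A B : Finset V} {T : Set V} (hAB : A ⊆ B) (hBT : (B : Set V) ⊆ T) (h : StrongIn α H A B)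
    (h' : StrongIn α H B T) : StrongIn α H A T := fun C hAC hCT =>
  (h (C ∩ B) (Finset.subset_inter hAC hAB) (by simp)).trans (h'.inter_le hα hBT hCT)

lemma PartialIso.strongIn_image [DecidableEq W] {H : ι → Set (Finset V)}
    {H' : ι → Set (Finset W)} {g : V → W} {A B : Finset V} (h : PartialIso H H' g B) (hAB : A ⊆ B)
    (hs : StrongIn α H A B) : StrongIn α H' (A.image g) ((B.image g : Finset W) : Set W) := by
  intro C hAC hCB
  obtain ⟨D, hD, rfl⟩ := Finset.subset_image_iff.1 (show C ⊆ B.image g by exact_mod_cast hCB)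
  have hDB : D ⊆ B := by exact_mod_cast hD
  rw [(h.mono hAB).delta_image, (h.mono hDB).delta_image]
  refine hs D (fun x hx => ?_) hD
  obtain ⟨y, hy, hxy⟩ := Finset.mem_image.1 (hAC (Finset.mem_image_of_mem g hx))
  rwa [← h.1 (hDB hy) (hAB hx) hxy]

/-- Negative relative predimensions over `m` points are bounded away from zero. -/
lemma exists_gap (hα : ∀ R, 0 < α R) (m : ℕ) : ∃ ε : ℝ, 0 < ε ∧
    ∀ j ≤ m, ∀ k : ι → ℕ, (j : ℝ) - ∑ R, α R * (k R : ℝ) < 0 →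
      (j : ℝ) - ∑ R, α R * (k R : ℝ) ≤ -ε := by
  classical
  let F : ℕ × (ι → ℕ) → ℝ := fun q => (∑ R, α R * (q.2 R : ℝ)) - q.1
  -- Truncating at `1` makes the set of drops finite whatever the reals `α R` are: `F ≤ 1` gives `α
  -- R * k R ≤ m + 1` for each `R`. Drops above `1` are covered by `min ε 1` below.
  let s : Set (ℕ × (ι → ℕ)) := {q | q.1 ≤ m ∧ 0 < F q ∧ F q ≤ 1}
  have hs : s.Finite := by
    refine ((Set.finite_Iic m).prod (Set.finite_Iic fun R => ⌈((m : ℝ) + 1) / α R⌉₊)).subset ?_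
    rintro ⟨j, k⟩ ⟨hj, -, hle⟩
    refine ⟨hj, fun R => ?_⟩
    have h1 : α R * (k R : ℝ) ≤ ∑ R, α R * (k R : ℝ) :=
      Finset.single_le_sum (f := fun R => α R * (k R : ℝ))
        (fun R _ => mul_nonneg (hα R).le (Nat.cast_nonneg _)) (Finset.mem_univ R)
    have h2 : (j : ℝ) ≤ m := by exact_mod_cast hj
    have h3 : (k R : ℝ) ≤ ((m : ℝ) + 1) / α R := by
      rw [le_div_iff₀ (hα R)]
      simp only [F] at hle
      linarith
    exact_mod_cast h3.trans (Nat.le_ceil _)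
  obtain ⟨ε, hε, hmin⟩ : ∃ ε : ℝ, 0 < ε ∧ ∀ q ∈ s, ε ≤ F q := by
    rcases s.eq_empty_or_nonempty with h | h
    · exact ⟨1, one_pos, by simp [h]⟩
    · obtain ⟨q, hq, hmin⟩ := Set.exists_min_image s F hs h
      exact ⟨F q, hq.2.1, hmin⟩
  refine ⟨min ε 1, lt_min hε one_pos, fun j hj k hneg => ?_⟩
  by_cases h1 : F (j, k) ≤ 1
  · have := hmin (j, k) ⟨hj, by simp only [F]; linarith, h1⟩
    have := min_le_left ε 1
    simp only [F] at *
    linarith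
  · have := min_le_right ε 1
    simp only [F] at *
    linarith

/-- The predimension drops by at least a fixed amount, if it drops at all, when at most `m` points
are added. -/
lemma exists_delta_gap (hα : ∀ R, 0 < α R) (m : ℕ) : ∃ ε : ℝ, 0 < ε ∧
    ∀ {V : Type w} (H : ι → Set (Finset V)) (A C : Finset V), A ⊆ C → C.card ≤ A.card + m →
      delta α H A - ε < delta α H C → delta α H A ≤ delta α H C := by
  obtain ⟨ε, hε, h⟩ := exists_gap hα m
  refine ⟨ε, hε, fun H A C hAC hcard hlt => ?_⟩
  have hc := Finset.card_le_card hAC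
  have key : delta α H C - delta α H A = ((C.card - A.card : ℕ) : ℝ) -
      ∑ R, α R * ((edgeCount H R C - edgeCount H R A : ℕ) : ℝ) := by
    have : ∀ R, ((edgeCount H R C - edgeCount H R A : ℕ) : ℝ) =
        edgeCount H R C - edgeCount H R A := fun R => Nat.cast_sub (edgeCount_mono H R hAC)
    simp only [this, Nat.cast_sub hc, mul_sub, Finset.sum_sub_distrib]
    unfold delta
    ring
  by_contra hne
  have := h (C.card - A.card) (by omega) (fun R => edgeCount H R C - edgeCount H R A)
    (by rw [← key]; linarith)
  rw [← key] at this
  linarith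

/-- A superset of bounded size whose predimension is almost minimal among the supersets with `p`
more points. -/
lemma exists_almost_minimal (H : ι → Set (Finset V)) (X : Finset V) {ε l : ℝ} {p I : ℕ}
    (hI : delta α H X - l < I * ε)
    (hl : ∀ C, X ⊆ C → C.card ≤ X.card + I * p → l ≤ delta α H C) :
    ∃ i < I, ∃ A, X ⊆ A ∧ A.card ≤ X.card + i * p ∧
      ∀ C, X ⊆ C → C.card ≤ X.card + (i + 1) * p → delta α H A - ε < delta α H C := by
  by_contra! hcon
  -- Each failure of near-minimality yields a competitor lower by `ε`, with room for `p` more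
  -- points; `I` failures would sink below `l`. A competitor contains `X` but not necessarily its
  -- predecessor.
  have key : ∀ i ≤ I, ∃ A, X ⊆ A ∧ A.card ≤ X.card + i * p ∧
      delta α H A ≤ delta α H X - i * ε := by
    intro i
    induction i with
    | zero => exact fun _ => ⟨X, subset_rfl, by simp, by simp⟩
    | succ i ih =>
      intro hi
      obtain ⟨A, hXA, hA, hd⟩ := ih (by omega)
      obtain ⟨C, hXC, hC, hCd⟩ := hcon i (by omega) A hXA hA
      refine ⟨C, hXC, hC, ?_⟩
      push_cast
      linarith
  obtain ⟨A, hXA, hA, hd⟩ := key I le_rfl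
  have := hl A hXA hA
  linarith

lemma delta_insert_le [DecidableEq V] (hα : ∀ R, 0 < α R) (H : ι → Set (Finset V))
    (A : Finset V) (b : V) : delta α H (insert b A) ≤ delta α H A + 1 := by
  have hc : ((insert b A).card : ℝ) ≤ A.card + 1 := by exact_mod_cast Finset.card_insert_le b A
  have hs : ∑ R, α R * (edgeCount H R A : ℝ) ≤ ∑ R, α R * (edgeCount H R (insert b A) : ℝ) :=
    Finset.sum_le_sum fun R _ => mul_le_mul_of_nonneg_left
      (by exact_mod_cast edgeCount_mono H R (Finset.subset_insert b A)) (hα R).le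
  unfold delta
  linarith

end Hypergraph

/-! ### Free amalgamation over a strong base. -/

section FreeAmalgam

variable {ι : Type*} {W : Type*}

/-- The free amalgam, with vertices in `ℕ`, of a hypergraph on `P ⊆ ℕ` and one on `B` over a
common part `A`. -/
lemma exists_free_amalgam [Countable W] {E : ι → Set (Finset W)} {A B : Finset W}
    {H : ι → Set (Finset ℕ)} {P : Finset ℕ} {f : W → ℕ} (hf : PartialIso E H f A)
    (hfP : ∀ a ∈ A, f a ∈ P) :
    ∃ (H' : ι → Set (Finset ℕ)) (g : W → ℕ), PartialIso E H' g B ∧ (∀ a ∈ A, g a = f a) ∧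
      (∀ b ∈ B, g b ∈ P → b ∈ A) ∧ (∀ R, ∀ S ⊆ P, S ∈ H' R ↔ S ∈ H R) ∧
      (∀ R, ∀ S ∈ H' R, (S ⊆ P ∧ S ∈ H R) ∨ ∃ T ⊆ B, T ∈ E R ∧ S = T.image g) := by
  classical
  obtain ⟨e, he⟩ := exists_injective_nat W
  -- The vertices outside `A` are placed above `P.sup id`, hence off `P`.
  let g : W → ℕ := fun b => if b ∈ A then f b else P.sup id + 1 + e b
  have hgA : ∀ a ∈ A, g a = f a := fun a ha => if_pos ha
  have hgA' : ∀ b ∉ A, g b = P.sup id + 1 + e b := fun b hb => if_neg hb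
  have hPlt : ∀ x ∈ P, x < P.sup id + 1 := fun x hx => Nat.lt_succ_of_le
    (Finset.le_sup (f := id) hx)
  have hgP : ∀ b, g b ∈ P → b ∈ A := by
    intro b hb
    by_contra hbA
    have := hPlt _ hb
    rw [hgA' b hbA] at this
    omega
  have hinj : Function.Injective g := by
    intro x y hxy
    by_cases hx : x ∈ A
    · have hy : y ∈ A := hgP y (by rw [← hxy, hgA x hx]; exact hfP x hx)
      rw [hgA x hx, hgA y hy] at hxy
      exact hf.1 hx hy hxy
    · by_cases hy : y ∈ A
      · exact absurd (hgP x (by rw [hxy, hgA y hy]; exact hfP y hy)) hx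
      · rw [hgA' x hx, hgA' y hy] at hxy
        exact he (by omega)
  have himg : ∀ T ⊆ A, T.image g = T.image f := fun T hT =>
    Finset.image_congr fun x hx => hgA x (hT hx)
  have hsub : ∀ T : Finset W, T.image g ⊆ P → T ⊆ A := fun T hT x hx =>
    hgP x (hT (Finset.mem_image_of_mem g hx))
  let H' : ι → Set (Finset ℕ) := fun R =>
    {S | (S ⊆ P ∧ S ∈ H R) ∨ ∃ T ⊆ B, T ∈ E R ∧ S = T.image g}
  refine ⟨H', g, ⟨hinj.injOn, fun R S hS => ?_⟩, hgA, fun b _ => hgP b, fun R S hS => ?_,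
    fun R S hS => hS⟩
  · constructor
    · exact fun h => Or.inr ⟨S, hS, h, rfl⟩
    · rintro (⟨h1, h2⟩ | ⟨T, -, hT, hTS⟩)
      · have hSA := hsub S h1
        rw [himg S hSA] at h2
        exact (hf.2 R S hSA).2 h2
      · rwa [Finset.image_injective hinj hTS]
  · constructor
    · rintro (⟨-, h⟩ | ⟨T, -, hT, rfl⟩)
      · exact h
      · have hTA := hsub T hS
        rw [himg T hTA]
        exact (hf.2 R T hTA).1 hT
    · exact fun h => Or.inl ⟨hS, h⟩

variable [Fintype ι] {α : ι → ℝ} {V : Type*} [DecidableEq V]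

/-- In a free join of `P` and `Q` over `P ∩ Q`, the predimension of a set over `P` is that of
its trace on `Q` over `P ∩ Q`. -/
lemma delta_of_free_join {H : ι → Set (Finset V)} {P Q : Finset V}
    (hfree : ∀ R, ∀ S ∈ H R, S ⊆ P ∪ Q → S ⊆ P ∨ S ⊆ Q) {Y : Finset V} (hY : Y ⊆ P ∪ Q) :
    delta α H Y + delta α H (Y ∩ (P ∩ Q)) = delta α H (Y ∩ P) + delta α H (Y ∩ Q) := by
  have h1 : Y ∩ P ∪ Y ∩ Q = Y := by
    rw [← Finset.inter_union_distrib_left]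
    exact Finset.inter_eq_left.2 hY
  have h2 : Y ∩ P ∩ (Y ∩ Q) = Y ∩ (P ∩ Q) := by
    ext x
    simp only [Finset.mem_inter]
    tauto
  have h := delta_union_add_inter_eq (α := α) H (Y ∩ P) (Y ∩ Q) (by
    intro R S hS hSY
    rw [h1] at hSY
    exact (hfree R S hS (hSY.trans hY)).imp (Finset.subset_inter hSY) (Finset.subset_inter hSY))
  rwa [h1, h2] at h

/-- By `delta_of_free_join`, `δ(Y)` is `δ(Y ∩ P)` plus the increment from `Y ∩ P ∩ Q` to `Y ∩ Q`;
this increment is nonnegative since `P ∩ Q` is strong in `Q`. -/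
lemma free_join_nonneg (hα : ∀ R, 0 < α R) {H : ι → Set (Finset V)} {P Q : Finset V}
    (hfree : ∀ R, ∀ S ∈ H R, S ⊆ P ∪ Q → S ⊆ P ∨ S ⊆ Q)
    (hQ : StrongIn α H (P ∩ Q) Q) (hP : ∀ Y ⊆ P, 0 ≤ delta α H Y) {Y : Finset V}
    (hY : Y ⊆ P ∪ Q) : 0 ≤ delta α H Y := by
  have h1 := delta_of_free_join (α := α) hfree hY
  have h2 := hQ.inter_le hα (by exact_mod_cast Finset.inter_subset_right)
    (C := Y ∩ Q) (by exact_mod_cast Finset.inter_subset_right)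
  have h3 : Y ∩ Q ∩ (P ∩ Q) = Y ∩ (P ∩ Q) := by
    ext x
    simp only [Finset.mem_inter]
    tauto
  rw [h3] at h2
  have h4 := hP (Y ∩ P) Finset.inter_subset_right
  linarith

lemma free_join_strong {H : ι → Set (Finset V)} {P Q : Finset V}
    (hfree : ∀ R, ∀ S ∈ H R, S ⊆ P ∪ Q → S ⊆ P ∨ S ⊆ Q)
    (hQ : StrongIn α H (P ∩ Q) Q) :
    StrongIn α H P ((P ∪ Q : Finset V) : Set V) := by
  intro Y hPY hY
  have h1 := delta_of_free_join (α := α) hfree (by exact_mod_cast hY)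
  have h2 : Y ∩ P = P := Finset.inter_eq_right.2 hPY
  have h3 : Y ∩ (P ∩ Q) = P ∩ Q :=
    Finset.inter_eq_right.2 (Finset.inter_subset_left.trans hPY)
  have h4 := hQ (Y ∩ Q) (Finset.subset_inter (Finset.inter_subset_left.trans hPY)
    Finset.inter_subset_right) (by simp)
  rw [h2, h3] at h1
  linarith

end FreeAmalgam

/-! ### Symmetric irreflexive structures as hypergraphs. -/

section Structures

variable {L : FirstOrder.Language.{u, v}}

/-- The coloured hypergraph of a structure. -/
def edges (L : FirstOrder.Language.{u, v}) (M : Type w) [L.Structure M] :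
    (Σ n, L.Relations n) → Set (Finset M) :=
  fun R => {S | ∃ x : Fin R.1 → M, Set.range x = (S : Set M) ∧ Structure.RelMap R.2 x}

section

variable {M : Type w} [L.Structure M]

lemma predim_eq_delta [Fintype (Σ n, L.Relations n)] (α : (Σ n, L.Relations n) → ℝ)
    (A : Finset M) : predim α A = delta α (edges L M) A := rfl

/-- Two injective enumerations of the same set differ by a permutation, so symmetry makes the edge
sets determine the relations. -/
lemma relMap_iff_mem_edges [DecidableEq M] (hM : SymmIrrefl L M) {n : ℕ} (R : L.Relations n)
    (x : Fin n → M) : Structure.RelMap R x ↔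
      Function.Injective x ∧ Finset.univ.image x ∈ edges L M ⟨n, R⟩ := by
  constructor
  · exact fun h => ⟨(hM n R x h).1, x, by simp, h⟩
  · rintro ⟨hx, y, hy, hR⟩
    have hyinj := (hM n R y hR).1
    have hrange : Set.range y = Set.range x := by simpa using hy
    have hex : ∀ i, ∃ j, y j = x i := fun i => by
      have : x i ∈ Set.range y := hrange ▸ Set.mem_range_self i
      exact this
    choose σ hσ using hex
    have hσinj : Function.Injective σ := fun i j hij => hx (by rw [← hσ i, ← hσ j, hij])
    have := (hM n R y hR).2 (Equiv.ofBijective σ (Finite.injective_iff_bijective.1 hσinj))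
    convert this using 1
    funext i
    exact (hσ i).symm

lemma card_of_mem_edges (hM : SymmIrrefl L M) {R : Σ n, L.Relations n} {S : Finset M}
    (hS : S ∈ edges L M R) : S.card = R.1 := by
  classical
  obtain ⟨x, hx, hR⟩ := hS
  have : S = Finset.univ.image x := by
    apply Finset.coe_injective
    simp [hx]
  rw [this, Finset.card_image_of_injective _ (hM _ _ x hR).1]
  simp

lemma partialIso_of_embedding {A : Type w'} [L.Structure A] [DecidableEq M] (f : A ↪[L] M)
    (B : Finset A) : PartialIso (edges L A) (edges L M) f B := by
  refine ⟨f.injective.injOn, fun R S _ => ⟨?_, ?_⟩⟩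
  · rintro ⟨x, hx, hR⟩
    exact ⟨f ∘ x, by rw [Set.range_comp, hx, Finset.coe_image], (f.map_rel R.2 x).2 hR⟩
  · rintro ⟨y, hy, hR⟩
    have hex : ∀ i, ∃ a, f a = y i := fun i => by
      have : y i ∈ ((S.image f : Finset M) : Set M) := hy ▸ Set.mem_range_self i
      obtain ⟨a, -, ha⟩ := Finset.mem_image.1 (Finset.mem_coe.1 this)
      exact ⟨a, ha⟩
    choose x hx using hex
    obtain rfl : f ∘ x = y := funext hx
    refine ⟨x, ?_, (f.map_rel R.2 x).1 hR⟩
    rw [Set.range_comp, Finset.coe_image] at hy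
    exact f.injective.image_injective hy

/-- An isomorphism of hypergraphs is an embedding of structures. -/
def embeddingOfPartialIso [L.IsRelational] {A : Type w'} [L.Structure A] [DecidableEq M]
    [DecidableEq A] (hA : SymmIrrefl L A) (hM : SymmIrrefl L M) (f : A → M)
    (hf : ∀ B, PartialIso (edges L A) (edges L M) f B) : A ↪[L] M where
  toFun := f
  inj' := fun x y h => (hf {x, y}).1 (by simp) (by simp) h
  map_fun' := fun g => isEmptyElim g
  map_rel' := fun {n} R x => by
    have hinj : Function.Injective f := fun x y h => (hf {x, y}).1 (by simp) (by simp) h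
    rw [relMap_iff_mem_edges hM, relMap_iff_mem_edges hA, hinj.of_comp_iff,
      (hf (Finset.univ.image x)).2 _ _ subset_rfl, Finset.image_image]

end

section

variable {V : Type w}

/-- The structure with a given coloured hypergraph. -/
@[reducible] def hypergraphStructure [L.IsRelational] [DecidableEq V]
    (H : (Σ n, L.Relations n) → Set (Finset V)) : L.Structure V where
  funMap := fun f => isEmptyElim f
  RelMap := fun {n} R x => Function.Injective x ∧ Finset.univ.image x ∈ H ⟨n, R⟩

variable [L.IsRelational] [DecidableEq V] (H : (Σ n, L.Relations n) → Set (Finset V))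

lemma symmIrrefl_hypergraphStructure :
    @SymmIrrefl L V (hypergraphStructure H) := by
  let _ := hypergraphStructure H
  rintro n R x ⟨hx, hR⟩
  refine ⟨hx, fun σ => ⟨hx.comp σ.injective, ?_⟩⟩
  rwa [← Finset.image_image, Finset.image_univ_equiv]

lemma edges_hypergraphStructure (hH : ∀ R, ∀ S ∈ H R, S.card = R.1) :
    @edges L V (hypergraphStructure H) = H := by
  let _ := hypergraphStructure H
  funext R
  ext S
  constructor
  · rintro ⟨x, hx, -, hR⟩
    convert hR
    apply Finset.coe_injective
    simp [hx]
  · intro hS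
    have e : Fin R.1 ≃ S := (finCongr (hH R S hS).symm).trans S.equivFin.symm
    have himg : Finset.univ.image (fun i => (e i : V)) = S := by
      ext a
      simp only [Finset.mem_image, Finset.mem_univ, true_and]
      exact ⟨fun ⟨i, hi⟩ => hi ▸ (e i).2, fun ha => ⟨e.symm ⟨a, ha⟩, by simp⟩⟩
    refine ⟨fun i => e i, ?_, Subtype.val_injective.comp e.injective, ?_⟩
    · rw [← Set.image_univ, ← Finset.coe_univ, ← Finset.coe_image, himg]
    · rwa [himg]

/-- The restriction of a hypergraph to a set of vertices. -/
def restrictHypergraph {ι : Type*} (H : ι → Set (Finset V)) (P : Finset V) :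
    ι → Set (Finset {x // x ∈ P}) :=
  fun R => {S | S.image Subtype.val ∈ H R}

lemma partialIso_restrictHypergraph {ι : Type*} (H : ι → Set (Finset V)) (P : Finset V)
    (B : Finset {x // x ∈ P}) : PartialIso (restrictHypergraph H P) H Subtype.val B :=
  ⟨Subtype.val_injective.injOn, fun _ _ _ => Iff.rfl⟩

end

section

variable [Fintype (Σ n, L.Relations n)] {α : (Σ n, L.Relations n) → ℝ} {M : Type w} [L.Structure M]

lemma dimIn_coe_self (A : Finset M) : dimIn α (A : Set M) A = predim α A := by
  have : {r : ℝ | ∃ B : Finset M, A ⊆ B ∧ (B : Set M) ⊆ A ∧ r = predim α B} = {predim α A} := by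
    ext r
    constructor
    · rintro ⟨B, hAB, hBA, rfl⟩
      rw [subset_antisymm hAB (by exact_mod_cast hBA)]
      rfl
    · rintro rfl
      exact ⟨A, subset_rfl, subset_rfl, rfl⟩
  rw [dimIn, this, csInf_singleton]

/-- Replaces the infima in `Strong` by plain inequalities. Inside `A` the only superset of `A` is
`A` itself, so its dimension there is its predimension; conversely, cutting a set down to its trace
on `A` does not raise the predimension. Nonnegativity bounds the infima from below. -/
lemma strong_coe_iff (hα : ∀ R, 0 < α R) (hM : ∀ A : Finset M, 0 ≤ predim α A) {A : Finset M}
    {T : Set M} : Strong α (A : Set M) T ↔ (A : Set M) ⊆ T ∧ StrongIn α (edges L M) A T := by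
  classical
  have hbdd : ∀ (S : Set M) (X : Finset M),
      BddBelow {r : ℝ | ∃ B : Finset M, X ⊆ B ∧ (B : Set M) ⊆ S ∧ r = predim α B} := fun S X =>
    ⟨0, by rintro r ⟨B, -, -, rfl⟩; exact hM B⟩
  constructor
  · rintro ⟨hAT, h⟩
    refine ⟨hAT, fun C hAC hCT => ?_⟩
    rw [← predim_eq_delta, ← predim_eq_delta, ← dimIn_coe_self, h A subset_rfl]
    exact csInf_le (hbdd _ _) ⟨C, hAC, hCT, rfl⟩
  · rintro ⟨hAT, h⟩
    refine ⟨hAT, fun X hX => le_antisymm ?_ ?_⟩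
    · refine le_csInf ⟨predim α X, X, subset_rfl, hX.trans hAT, rfl⟩ ?_
      rintro r ⟨B, hXB, hBT, rfl⟩
      refine (csInf_le (hbdd _ _) ⟨B ∩ A, Finset.subset_inter hXB (by exact_mod_cast hX),
        by simp, rfl⟩).trans ?_
      exact h.inter_le hα hAT hBT
    · refine le_csInf ⟨predim α X, X, subset_rfl, hX, rfl⟩ ?_
      rintro r ⟨B, hXB, hBA, rfl⟩
      exact csInf_le (hbdd _ _) ⟨B, hXB, hBA.trans hAT, rfl⟩

lemma strongEmb_iff (hα : ∀ R, 0 < α R) (hM : ∀ A : Finset M, 0 ≤ predim α A) [DecidableEq M]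
    {A : Type w'} [L.Structure A] [Fintype A] (f : A ↪[L] M) :
    StrongEmb α f ↔ StrongIn α (edges L M) (Finset.univ.image f) Set.univ := by
  have : Set.range f = ((Finset.univ.image f : Finset M) : Set M) := by simp
  rw [StrongEmb, this, strong_coe_iff hα hM]
  simp

lemma StrongIn.univ_iff {ι V : Type*} [Fintype ι] {α : ι → ℝ} {H : ι → Set (Finset V)}
    {A : Finset V} : StrongIn α H A Set.univ ↔ ∀ C, A ⊆ C → delta α H A ≤ delta α H C :=
  ⟨fun h C hC => h C hC (Set.subset_univ _), fun h C hC _ => h C hC⟩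

end

end Structures

/-! ### Strong hulls and free extensions in a generic model. -/

section Generic

variable {L : FirstOrder.Language.{u, v}} [Fintype (Σ n, L.Relations n)]
  {α : (Σ n, L.Relations n) → ℝ} {M : Type w} [L.Structure M]

/-- A member of the chain is strong in all later members by transitivity, and every finite set lies
in some member. -/
lemma IsGeneric.exists_strong_superset (hα : ∀ R, 0 < α R) (hM : IsGeneric α M) (X : Finset M) :
    ∃ A, X ⊆ A ∧ StrongIn α (edges L M) A Set.univ := by
  classical
  obtain ⟨A, hA, hU⟩ := hM.chain
  have hmono : Monotone A := monotone_nat_of_le_succ fun i => by exact_mod_cast (hA i).1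
  have hcov : ∀ C : Finset M, ∃ i, C ⊆ A i := by
    intro C
    induction C using Finset.induction_on with
    | empty => exact ⟨0, by simp⟩
    | insert a C _ ih =>
      obtain ⟨i, hi⟩ := ih
      have ha : a ∈ ⋃ i, (A i : Set M) := hU ▸ Set.mem_univ a
      obtain ⟨j, hj⟩ := Set.mem_iUnion.1 ha
      refine ⟨max i j, Finset.insert_subset (hmono (le_max_right i j) hj)
        (hi.trans (hmono (le_max_left i j)))⟩
  have hstrong : ∀ i j, i ≤ j → StrongIn α (edges L M) (A i) (A j) := by
    intro i j hij
    induction j, hij using Nat.le_induction with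
    | base =>
      intro C h1 h2
      rw [subset_antisymm h1 (by exact_mod_cast h2)]
    | succ j hij ih =>
      obtain ⟨h1, h2⟩ := (strong_coe_iff hα hM.inK.2).1 (hA j)
      exact StrongIn.trans hα (hmono hij) h1 ih h2
  obtain ⟨i, hi⟩ := hcov X
  refine ⟨A i, hi, fun C hC _ => ?_⟩
  obtain ⟨j, hj⟩ := hcov C
  exact hstrong i (max i j) (le_max_left i j) C hC
    (by exact_mod_cast hj.trans (hmono (le_max_right i j)))

/-- The extension clause of genericity restated for hypergraphs on `ℕ`, by passing to the structures
induced on the finite sets `P` and `Q`. -/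
lemma IsGeneric.exists_extension [L.IsRelational] [DecidableEq M] (hα : ∀ R, 0 < α R)
    (hM : IsGeneric α M) {H : (Σ n, L.Relations n) → Set (Finset ℕ)}
    (hH : ∀ R, ∀ S ∈ H R, S.card = R.1) {P Q : Finset ℕ} (hPQ : P ⊆ Q)
    (hQ : ∀ Y ⊆ Q, 0 ≤ delta α H Y) (hs : StrongIn α H P Q) {f : ℕ → M}
    (hf : PartialIso H (edges L M) f P) (hfs : StrongIn α (edges L M) (P.image f) Set.univ) :
    ∃ g : ℕ → M, PartialIso H (edges L M) g Q ∧
      StrongIn α (edges L M) (Q.image g) Set.univ ∧ ∀ x ∈ P, g x = f x := by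
  have huni : ∀ X : Finset ℕ, ∀ R, ∀ S ∈ restrictHypergraph H X R, S.card = R.1 := by
    intro X R S hS
    rw [← hH R _ hS, Finset.card_image_of_injective _ Subtype.val_injective]
  let iP : L.Structure {x // x ∈ P} := hypergraphStructure (restrictHypergraph H P)
  let iQ : L.Structure {x // x ∈ Q} := hypergraphStructure (restrictHypergraph H Q)
  have eP : edges L {x // x ∈ P} = restrictHypergraph H P := edges_hypergraphStructure _ (huni P)
  have eQ : edges L {x // x ∈ Q} = restrictHypergraph H Q := edges_hypergraphStructure _ (huni Q)
  have isoP : ∀ B, PartialIso (edges L {x // x ∈ P}) H Subtype.val B := fun B => by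
    rw [eP]; exact partialIso_restrictHypergraph H P B
  have isoQ : ∀ B, PartialIso (edges L {x // x ∈ Q}) H Subtype.val B := fun B => by
    rw [eQ]; exact partialIso_restrictHypergraph H Q B
  have subP : ∀ B : Finset {x // x ∈ P}, B.image Subtype.val ⊆ P := fun B x hx => by
    obtain ⟨y, -, rfl⟩ := Finset.mem_image.1 hx
    exact y.2
  have subQ : ∀ B : Finset {x // x ∈ Q}, B.image Subtype.val ⊆ Q := fun B x hx => by
    obtain ⟨y, -, rfl⟩ := Finset.mem_image.1 hx
    exact y.2
  have symP : SymmIrrefl L {x // x ∈ P} := symmIrrefl_hypergraphStructure _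
  have symQ : SymmIrrefl L {x // x ∈ Q} := symmIrrefl_hypergraphStructure _
  have kP : InK0 α {x // x ∈ P} := ⟨inferInstance, symP, fun A => by
    rw [predim_eq_delta, ← (isoP A).delta_image]
    exact hQ _ ((subP A).trans hPQ)⟩
  have kQ : InK0 α {x // x ∈ Q} := ⟨inferInstance, symQ, fun A => by
    rw [predim_eq_delta, ← (isoQ A).delta_image]
    exact hQ _ (subQ A)⟩
  have imP : ∀ S : Finset {x // x ∈ P}, (S.image fun x => (⟨x.1, hPQ x.2⟩ : {x // x ∈ Q})).image
      Subtype.val = S.image Subtype.val := fun S => by rw [Finset.image_image]; rfl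
  let f' : {x // x ∈ P} ↪[L] M := embeddingOfPartialIso symP hM.inK.1 (fun x => f x.1)
    fun B => (isoP B).comp (hf.mono (subP B))
  let h' : {x // x ∈ P} ↪[L] {x // x ∈ Q} := embeddingOfPartialIso symP symQ
    (fun x => ⟨x.1, hPQ x.2⟩) fun B => ⟨fun x _ y _ hxy => Subtype.ext (Subtype.mk.inj hxy),
      fun R S _ => by
        rw [(isoP S).2 R S subset_rfl, (isoQ _).2 R _ subset_rfl, imP]⟩
  have univP : (Finset.univ : Finset {x // x ∈ P}).image Subtype.val = P := by
    ext x; simp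
  have univQ : (Finset.univ : Finset {x // x ∈ Q}).image Subtype.val = Q := by
    ext x; simp
  have hf' : StrongEmb α f' := by
    rw [strongEmb_iff hα hM.inK.2]
    convert hfs using 1
    conv_rhs => rw [← univP]
    rw [Finset.image_image]
    rfl
  have hh' : StrongEmb α h' := by
    rw [strongEmb_iff hα kQ.2.2, StrongIn.univ_iff]
    intro C hC
    rw [← (isoQ _).delta_image, ← (isoQ C).delta_image]
    have : (Finset.univ.image h').image Subtype.val = P := by
      conv_rhs => rw [← univP]
      exact imP _
    rw [this]
    refine hs _ ?_ (by exact_mod_cast subQ C)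
    rw [← this]
    exact Finset.image_subset_image hC
  obtain ⟨g, hg, hgf⟩ := hM.extension _ _ kP kQ f' h' hf' hh'
  have hgs := (strongEmb_iff hα hM.inK.2 g).1 hg
  let G : ℕ → M := fun x => if hx : x ∈ Q then g ⟨x, hx⟩ else f x
  have hG : ∀ x : {x // x ∈ Q}, G x.1 = g x := fun x => dif_pos x.2
  have hGim : ∀ S : Finset {x // x ∈ Q}, (S.image Subtype.val).image G = S.image g := fun S => by
    rw [Finset.image_image]
    exact Finset.image_congr fun x _ => hG x
  refine ⟨G, ⟨fun x hx y hy hxy => ?_, fun R S hS => ?_⟩, ?_, fun x hx => ?_⟩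
  · have hxy' : g ⟨x, hx⟩ = g ⟨y, hy⟩ := by rw [← hG ⟨x, hx⟩, ← hG ⟨y, hy⟩]; exact hxy
    exact Subtype.mk.inj (g.injective hxy')
  · obtain ⟨T, rfl⟩ : ∃ T : Finset {x // x ∈ Q}, T.image Subtype.val = S :=
      ⟨S.subtype (· ∈ Q), by
        ext x
        simp only [Finset.mem_image, Finset.mem_subtype, Subtype.exists, exists_and_left,
          exists_prop, exists_eq_right_right]
        exact ⟨fun h => h.1, fun h => ⟨h, hS h⟩⟩⟩
    rw [hGim, ← (partialIso_of_embedding g T).2 R T subset_rfl, (isoQ T).2 R T subset_rfl]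
  · rw [← univQ, hGim]
    exact hgs
  · have := hgf ⟨x, hx⟩
    rw [← hG] at this
    exact this

/-- A finite extension of a partial isomorphism can be realized freely over a given strong set. -/
lemma IsGeneric.exists_free_extension [L.IsRelational] [DecidableEq M] [Nonempty M]
    (hα : ∀ R, 0 < α R) (hM : IsGeneric α M) {A B : Finset M} (hAB : A ⊆ B)
    (hs : StrongIn α (edges L M) A B) {f : M → M} (hf : PartialIso (edges L M) (edges L M) f A)
    {D : Finset M} (hAD : A.image f ⊆ D) (hD : StrongIn α (edges L M) D Set.univ) :
    ∃ g : M → M, PartialIso (edges L M) (edges L M) g B ∧ (∀ a ∈ A, g a = f a) ∧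
      (∀ b ∈ B, g b ∈ D → b ∈ A) ∧ StrongIn α (edges L M) (D ∪ B.image g) Set.univ ∧
      ∀ R, ∀ S ∈ edges L M R, S ⊆ D ∪ B.image g → S ⊆ D ∨ S ⊆ B.image g := by
  have := hM.countable
  obtain ⟨e, he⟩ := exists_injective_nat M
  -- `M` is copied into `ℕ`, where the amalgam of `D` and `B` can be built on new vertices before
  -- genericity brings it back into `M`.
  let H : (Σ n, L.Relations n) → Set (Finset ℕ) := fun R => (Finset.image e) '' edges L M R
  have isoe : ∀ X, PartialIso (edges L M) H e X := fun X => ⟨he.injOn, fun R S _ =>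
    ⟨fun h => ⟨S, h, rfl⟩, fun ⟨T, hT, hTS⟩ => Finset.image_injective he hTS ▸ hT⟩⟩
  obtain ⟨H', g₁, hg₁, hg₁f, hg₁P, hH'P, hH'⟩ := exists_free_amalgam (E := edges L M) (A := A)
    (B := B) (H := H) (P := D.image e) (f := e ∘ f) (hf.comp (isoe _)) fun a ha =>
      Finset.mem_image_of_mem e (hAD (Finset.mem_image_of_mem f ha))
  have hfree : ∀ R, ∀ S ∈ H' R, S ⊆ D.image e ∨ S ⊆ B.image g₁ := by
    intro R S hS
    rcases hH' R S hS with h | ⟨T, hT, -, rfl⟩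
    · exact Or.inl h.1
    · exact Or.inr (Finset.image_subset_image hT)
  have hinter : D.image e ∩ B.image g₁ = A.image g₁ := by
    ext x
    rw [Finset.mem_inter]
    constructor
    · rintro ⟨h1, h2⟩
      obtain ⟨b, hb, rfl⟩ := Finset.mem_image.1 h2
      exact Finset.mem_image_of_mem _ (hg₁P b hb h1)
    · intro h
      refine ⟨?_, Finset.image_subset_image hAB h⟩
      obtain ⟨a, ha, rfl⟩ := Finset.mem_image.1 h
      rw [hg₁f a ha]
      exact Finset.mem_image_of_mem e (hAD (Finset.mem_image_of_mem f ha))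
  have hsQ : StrongIn α H' (D.image e ∩ B.image g₁) ((B.image g₁ : Finset ℕ) : Set ℕ) := by
    rw [hinter]
    exact hg₁.strongIn_image hAB hs
  have hinv : ∀ x, Function.invFun e (e x) = x := Function.leftInverse_invFun he
  have isoinv : PartialIso H' (edges L M) (Function.invFun e) (D.image e) := by
    refine ⟨?_, fun R S hS => ?_⟩
    · intro x hx y hy hxy
      obtain ⟨x, -, rfl⟩ := Finset.mem_image.1 (Finset.mem_coe.1 hx)
      obtain ⟨y, -, rfl⟩ := Finset.mem_image.1 (Finset.mem_coe.1 hy)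
      rw [hinv, hinv] at hxy
      rw [hxy]
    · rw [hH'P R S hS]
      obtain ⟨T, -, rfl⟩ := Finset.subset_image_iff.1 hS
      rw [Finset.image_image, (funext hinv : Function.invFun e ∘ e = id), Finset.image_id,
        (isoe T).2 R T subset_rfl]
  have hinvD : (D.image e).image (Function.invFun e) = D := by
    rw [Finset.image_image, (funext hinv : Function.invFun e ∘ e = id), Finset.image_id]
  have hPnonneg : ∀ Y ⊆ D.image e, 0 ≤ delta α H' Y := by
    intro Y hY
    rw [← (isoinv.mono hY).delta_image]
    exact hM.inK.2 _
  have hcard : ∀ R, ∀ S ∈ H' R, S.card = R.1 := by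
    intro R S hS
    rcases hH' R S hS with ⟨-, T, hT, rfl⟩ | ⟨T, hT, hTR, rfl⟩
    · rw [Finset.card_image_of_injective _ he, card_of_mem_edges hM.inK.1 hT]
    · rw [Finset.card_image_of_injOn (hg₁.mono hT).1, card_of_mem_edges hM.inK.1 hTR]
  -- The whole join of `D` and `B` is realized over the copy of `D`, so `D` stays fixed and freeness
  -- is inherited by the image.
  obtain ⟨h, hh, hhs, hhe⟩ := hM.exists_extension hα hcard
    (Finset.subset_union_left (s₁ := D.image e) (s₂ := B.image g₁))
    (fun Y hY => free_join_nonneg hα (fun R S hS _ => hfree R S hS) hsQ hPnonneg hY)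
    (free_join_strong (fun R S hS _ => hfree R S hS) hsQ) isoinv (by rwa [hinvD])
  have hhD : (D.image e).image h = D := by
    rw [Finset.image_congr (s := D.image e) hhe, hinvD]
  have hQim : (D.image e ∪ B.image g₁).image h = D ∪ B.image (h ∘ g₁) := by
    rw [Finset.image_union, hhD, Finset.image_image]
  rw [hQim] at hhs
  have hhe' : ∀ x ∈ D, h (e x) = x := fun x hx => by
    rw [hhe _ (Finset.mem_image_of_mem e hx), hinv]
  refine ⟨h ∘ g₁, hg₁.comp (hh.mono Finset.subset_union_right), fun a ha => ?_,
    fun b hb hbD => ?_, hhs, fun R S hS hSQ => ?_⟩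
  · rw [Function.comp_apply, hg₁f a ha, Function.comp_apply,
      hhe' _ (hAD (Finset.mem_image_of_mem f ha))]
  · refine hg₁P b hb ?_
    have h1 : h (g₁ b) = h (e (h (g₁ b))) := (hhe' _ hbD).symm
    have h2 := hh.1 (Finset.mem_union_right _ (Finset.mem_image_of_mem g₁ hb))
      (Finset.mem_union_left _ (Finset.mem_image_of_mem e hbD)) h1
    rw [h2]
    exact Finset.mem_image_of_mem e hbD
  · rw [← hQim] at hSQ
    obtain ⟨T, hT, rfl⟩ := Finset.subset_image_iff.1 hSQ
    have hTQ : T ⊆ D.image e ∪ B.image g₁ := by exact_mod_cast hT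
    rcases hfree R T ((hh.2 R T hTQ).2 hS) with h1 | h1
    · left
      rw [← hhD]
      exact Finset.image_subset_image h1
    · right
      rw [← Finset.image_image]
      exact Finset.image_subset_image h1

end Generic

/-! ### Existential types with blocks of bounded length. -/

section ExistentialTypes

variable (L : FirstOrder.Language.{u, v}) {M : Type w} [L.Structure M]

/-- Two tuples have the same quantifier-free type. -/
def QFEquiv {γ : Type} (a b : γ → M) : Prop :=
  (∀ i j, a i = a j ↔ b i = b j) ∧
    ∀ (R : Σ n, L.Relations n) (x : Fin R.1 → γ),
      Structure.RelMap R.2 (a ∘ x) ↔ Structure.RelMap R.2 (b ∘ x)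

/-- Every quantifier-free type realized over `a` by a `k`-tuple is realized over `a'`. -/
def ExistsLE (k : ℕ) {γ : Type} (a a' : γ → M) : Prop :=
  ∀ c : Fin k → M, ∃ c' : Fin k → M, QFEquiv L (Sum.elim a c) (Sum.elim a' c')

variable {L}

lemma QFEquiv.comp {γ γ' : Type} {a a' : γ → M} (h : QFEquiv L a a') (e : γ' → γ) :
    QFEquiv L (a ∘ e) (a' ∘ e) :=
  ⟨fun i j => h.1 (e i) (e j), fun R x => h.2 R (e ∘ x)⟩

lemma ExistsLE.comp {k : ℕ} {γ γ' : Type} {a a' : γ → M} (h : ExistsLE L k a a') (e : γ' → γ) :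
    ExistsLE L k (a ∘ e) (a' ∘ e) := fun c => by
  obtain ⟨c', hc'⟩ := h c
  refine ⟨c', ?_⟩
  have := hc'.comp (Sum.map e id)
  rwa [Sum.elim_comp_map, Sum.elim_comp_map] at this

lemma ExistsLE.qfEquiv {γ : Type} {a a' : γ → M} (h : ExistsLE L 0 a a') :
    QFEquiv L a a' := by
  obtain ⟨c', hc'⟩ := h Fin.elim0
  exact hc'.comp Sum.inl

lemma ExistsLE.mono [Nonempty M] {k l : ℕ} (hkl : k ≤ l) {γ : Type} {a a' : γ → M}
    (h : ExistsLE L l a a') : ExistsLE L k a a' := fun c => by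
  obtain ⟨c', hc'⟩ := h fun i => if hi : (i : ℕ) < k then c ⟨i, hi⟩ else Classical.arbitrary M
  refine ⟨c' ∘ Fin.castLE hkl, ?_⟩
  have := hc'.comp (Sum.map id (Fin.castLE hkl))
  rw [Sum.elim_comp_map, Sum.elim_comp_map, Function.comp_id, Function.comp_id] at this
  convert this using 2
  funext i
  simp

lemma QFEquiv.of_partialIso [DecidableEq M] (hM : SymmIrrefl L M) {g : M → M} {B : Finset M}
    (hg : PartialIso (edges L M) (edges L M) g B) {γ : Type} {a : γ → M} (ha : ∀ i, a i ∈ B) :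
    QFEquiv L a (g ∘ a) := by
  refine ⟨fun i j => ⟨fun h => congrArg g h, fun h => hg.1 (ha i) (ha j) h⟩, fun R x => ?_⟩
  have hsub : Finset.univ.image (a ∘ x) ⊆ B := fun y hy => by
    obtain ⟨i, -, rfl⟩ := Finset.mem_image.1 hy
    exact ha _
  have hinj : Function.Injective (a ∘ x) ↔ Function.Injective (g ∘ (a ∘ x)) :=
    ⟨fun h i j hij => h (hg.1 (ha _) (ha _) hij), fun h => h.of_comp⟩
  rw [relMap_iff_mem_edges hM, Function.comp_assoc, relMap_iff_mem_edges hM, hinj,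
    hg.2 _ _ hsub, Finset.image_image]

lemma QFEquiv.exists_partialIso [DecidableEq M] {γ : Type} [Fintype γ] {a a' : γ → M}
    (h : QFEquiv L a a') : ∃ F : M → M,
      PartialIso (edges L M) (edges L M) F (Finset.univ.image a) ∧ ∀ i, F (a i) = a' i := by
  classical
  let F : M → M := fun x => if hx : ∃ i, a i = x then a' hx.choose else x
  have hF : ∀ i, F (a i) = a' i := fun i => by
    have hx : ∃ j, a j = a i := ⟨i, rfl⟩
    simp only [F, dif_pos hx]
    exact (h.1 _ _).1 hx.choose_spec
  have hinj : Set.InjOn F (Finset.univ.image a : Finset M) := by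
    intro x hx y hy hxy
    obtain ⟨i, -, rfl⟩ := Finset.mem_image.1 (Finset.mem_coe.1 hx)
    obtain ⟨j, -, rfl⟩ := Finset.mem_image.1 (Finset.mem_coe.1 hy)
    rw [hF, hF] at hxy
    exact (h.1 i j).2 hxy
  refine ⟨F, ⟨hinj, fun R S hS => ⟨?_, ?_⟩⟩, hF⟩
  · rintro ⟨x, hx, hR⟩
    have hex : ∀ i, ∃ j, a j = x i := fun i => by
      have hi : x i ∈ S := by
        rw [← Finset.mem_coe, ← hx]
        exact Set.mem_range_self i
      obtain ⟨j, -, hj⟩ := Finset.mem_image.1 (hS hi)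
      exact ⟨j, hj⟩
    choose y hy using hex
    obtain rfl : a ∘ y = x := funext hy
    refine ⟨a' ∘ y, ?_, (h.2 R y).1 hR⟩
    have : a' ∘ y = F ∘ (a ∘ y) := funext fun i => (hF (y i)).symm
    rw [this, Set.range_comp, hx, Finset.coe_image]
  · rintro ⟨x, hx, hR⟩
    have hex : ∀ i, ∃ j, a j ∈ S ∧ a' j = x i := fun i => by
      have hi : x i ∈ S.image F := by
        rw [← Finset.mem_coe, ← hx]
        exact Set.mem_range_self i
      obtain ⟨z, hz, hzi⟩ := Finset.mem_image.1 hi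
      obtain ⟨j, -, rfl⟩ := Finset.mem_image.1 (hS hz)
      exact ⟨j, hz, by rw [← hF, hzi]⟩
    choose y hyS hy using hex
    obtain rfl : a' ∘ y = x := funext hy
    refine ⟨a ∘ y, ?_, (h.2 R y).2 hR⟩
    have : a' ∘ y = F ∘ (a ∘ y) := funext fun i => (hF (y i)).symm
    rw [this, Set.range_comp, Finset.coe_image] at hx
    refine (hinj.image_eq_image_iff ?_ (by exact_mod_cast hS)).1 hx
    rintro z ⟨i, rfl⟩
    exact Finset.mem_coe.2 (Finset.mem_image_of_mem a (Finset.mem_univ _))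

lemma exists_tuple_covering [Nonempty M] {k : ℕ} (s : Finset M) (hs : s.card ≤ k) :
    ∃ c : Fin k → M, ∀ x ∈ s, ∃ i, c i = x := by
  refine ⟨fun i => if hi : (i : ℕ) < s.card then (s.equivFin.symm ⟨i, hi⟩ : M)
    else Classical.arbitrary M, fun x hx => ?_⟩
  refine ⟨⟨s.equivFin ⟨x, hx⟩, (s.equivFin ⟨x, hx⟩).2.trans_le hs⟩, ?_⟩
  simp

/-- Enumerating the at most `k` points of `C` off the tuple `a` turns the comparison of types into a
copy of `C` over `a'`; this is how bounded sets are transported. -/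
lemma ExistsLE.exists_partialIso [DecidableEq M] [Nonempty M] {k : ℕ} {γ : Type} [Fintype γ]
    {a a' : γ → M} (h : ExistsLE L k a a') {C : Finset M} (haC : Finset.univ.image a ⊆ C)
    (hC : C.card ≤ (Finset.univ.image a).card + k) : ∃ F : M → M,
      PartialIso (edges L M) (edges L M) F C ∧ ∀ i, F (a i) = a' i := by
  obtain ⟨c, hc⟩ := exists_tuple_covering (k := k) (C \ Finset.univ.image a) (by
    rw [Finset.card_sdiff_of_subset haC]
    omega)
  obtain ⟨c', hc'⟩ := h c
  obtain ⟨F, hF, hFa⟩ := hc'.exists_partialIso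
  refine ⟨F, hF.mono fun x hx => ?_, fun i => hFa (Sum.inl i)⟩
  by_cases hxa : x ∈ Finset.univ.image a
  · obtain ⟨i, -, rfl⟩ := Finset.mem_image.1 hxa
    exact Finset.mem_image_of_mem (Sum.elim a c) (Finset.mem_univ (Sum.inl i))
  · obtain ⟨i, rfl⟩ := hc x (Finset.mem_sdiff.2 ⟨hx, hxa⟩)
    exact Finset.mem_image_of_mem (Sum.elim a c) (Finset.mem_univ (Sum.inr i))

end ExistentialTypes

/-! ### The back-and-forth step. -/

section Lookahead

variable {L : FirstOrder.Language.{u, v}} [L.IsRelational] [Fintype (Σ n, L.Relations n)]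
  {α : (Σ n, L.Relations n) → ℝ} {M : Type w} [L.Structure M]

/-- A set that is strong up to `m` controls the `m`-tuples over it. -/
lemma IsGeneric.existsLE_of_strongUpTo [DecidableEq M] [Nonempty M] (hα : ∀ R, 0 < α R)
    (hM : IsGeneric α M) {m : ℕ} {B : Finset M} (hB : StrongUpTo α (edges L M) m B) {g : M → M}
    (hg : PartialIso (edges L M) (edges L M) g B) {γ : Type} {a : γ → M} (ha : ∀ i, a i ∈ B) :
    ExistsLE L m a (g ∘ a) := by
  intro c
  -- `B.image g` need not be strong in `M`, so the extension of `B` by `c` is realized freely over a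
  -- strong hull `D` of it.
  obtain ⟨D, hBD, hD⟩ := hM.exists_strong_superset hα (B.image g)
  let C : Finset M := B ∪ Finset.univ.image c
  have hCcard : C.card ≤ B.card + m := (Finset.card_union_le _ _).trans
    (Nat.add_le_add_left (Finset.card_image_le.trans (by simp)) _)
  have hBC : StrongIn α (edges L M) B (C : Set M) := fun Y hBY hYC =>
    hB Y hBY ((Finset.card_le_card (by exact_mod_cast hYC)).trans hCcard)
  obtain ⟨h, hh, hhg, -⟩ := hM.exists_free_extension hα Finset.subset_union_left hBC hg hBD hD
  refine ⟨h ∘ c, ?_⟩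
  have hac : ∀ i, Sum.elim a c i ∈ C := by
    rintro (i | i)
    · exact Finset.mem_union_left _ (ha i)
    · exact Finset.mem_union_right _ (Finset.mem_image_of_mem c (Finset.mem_univ i))
  convert QFEquiv.of_partialIso hM.inK.1 hh hac using 1
  rw [Sum.comp_elim]
  congr 1
  funext i
  exact (hhg _ (ha i)).symm

/-- A free extension, over a strong set, of a set that is strong up to `m` by a strong set is
strong up to `m`. -/
lemma strongUpTo_of_free {ι V : Type*} [Fintype ι] [DecidableEq V] {α : ι → ℝ}
    (hα : ∀ R, 0 < α R) {H : ι → Set (Finset V)} {A B D : Finset V} {m : ℕ}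
    (hA : StrongUpTo α H m A) (hAB : D ∩ B = A) (hD : StrongIn α H (D ∪ B) Set.univ)
    (hfree : ∀ R, ∀ S ∈ H R, S ⊆ D ∪ B → S ⊆ D ∨ S ⊆ B) : StrongUpTo α H m B := by
  intro C hBC hC
  -- Strength of `D ∪ B` allows `C` to be replaced by its trace `Y`. By freeness, `δ(Y) - δ(B) = δ(Y
  -- ∩ D) - δ(A)`, and `Y ∩ D` exceeds `A` by as many points as `Y` exceeds `B`, hence by at most
  -- `m`.
  have h1 := hD.inter_le hα (Set.subset_univ _) (C := C) (Set.subset_univ _)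
  set Y := C ∩ (D ∪ B) with hY
  have hBY : B ⊆ Y := Finset.subset_inter hBC Finset.subset_union_right
  have h2 := delta_of_free_join (α := α) hfree (Y := Y) Finset.inter_subset_right
  have hYB : Y ∩ B = B := Finset.inter_eq_right.2 hBY
  have hYA : Y ∩ (D ∩ B) = A := by
    rw [← hAB]
    exact Finset.inter_eq_right.2 (Finset.inter_subset_right.trans hBY)
  rw [hYB, hYA] at h2
  have hAY : A ⊆ Y ∩ D := by
    rw [← hAB]
    exact Finset.subset_inter (Finset.inter_subset_right.trans hBY) Finset.inter_subset_left
  have hcard : (Y ∩ D).card + B.card = Y.card + A.card := by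
    have h3 := Finset.card_union_add_card_inter (Y ∩ D) B
    have h4 : Y ∩ D ∪ B = Y := by
      apply subset_antisymm
      · exact Finset.union_subset Finset.inter_subset_left hBY
      · intro x hx
        rcases Finset.mem_union.1 (Finset.mem_inter.1 hx).2 with h | h
        · exact Finset.mem_union_left _ (Finset.mem_inter.2 ⟨hx, h⟩)
        · exact Finset.mem_union_right _ h
    have h5 : Y ∩ D ∩ B = A := by
      rw [Finset.inter_assoc, hYA]
    rw [h4, h5] at h3
    exact h3.symm
  have hYC : Y.card ≤ C.card := Finset.card_le_card Finset.inter_subset_left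
  have h3 := hA (Y ∩ D) hAY (by omega)
  linarith

/-- The existential type of `a` with long enough blocks of quantifiers determines which
existential types with short blocks of quantifiers the tuples `ab` have. -/
theorem IsGeneric.exists_lookahead (hα : ∀ R, 0 < α R) (hM : IsGeneric α M) (n m : ℕ) :
    ∃ k, ∀ (γ : Type) [Fintype γ], Fintype.card γ ≤ n → ∀ a a' : γ → M,
      ExistsLE L k a a' → ExistsLE L k a' a → ∀ b : M, ∃ b' : M,
        ExistsLE L m (Sum.elim a fun _ : Unit => b) (Sum.elim a' fun _ : Unit => b') ∧
        ExistsLE L m (Sum.elim a' fun _ : Unit => b') (Sum.elim a fun _ : Unit => b) := by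
  classical
  obtain ⟨ε, hε, hgap⟩ := exists_delta_gap.{w} hα m
  obtain ⟨I, hI⟩ := exists_nat_gt (1 / ε)
  rw [div_lt_iff₀ hε] at hI
  have hI0 : 1 ≤ I := by
    rcases Nat.eq_zero_or_pos I with rfl | h
    · norm_num at hI
    · exact h
  -- One point for `b` and `I` rounds of `m` points: `p` bounds what is added to `A` in building `B`
  -- and in testing its near-minimality.
  set p := 1 + I * m with hp
  have hmp : m ≤ p := by
    have := Nat.mul_le_mul_right m hI0
    omega
  obtain ⟨ε', hε', hgap'⟩ := exists_delta_gap.{w} hα p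
  -- The descent from `X` starts at `δ(X) ≤ n`, ends above `0` and loses `ε'` per round, so `J`
  -- rounds of `p` points suffice; hence the level `J * p`.
  obtain ⟨J, hJ⟩ := exists_nat_gt (n / ε')
  rw [div_lt_iff₀ hε'] at hJ
  refine ⟨J * p, fun γ _ hγ a a' haa' ha'a b => ?_⟩
  have : Nonempty M := ⟨b⟩
  set E := edges L M
  set X := Finset.univ.image a with hX
  set X' := Finset.univ.image a' with hX'
  have hXn : (X.card : ℝ) ≤ n := by
    exact_mod_cast (Finset.card_image_le.trans (by simpa using hγ))
  obtain ⟨j, hjJ, A, hXA, hAcard, hAmin⟩ := exists_almost_minimal (α := α) E X (ε := ε') (l := 0)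
    (p := p) (I := J) (by have := delta_le_card hα E X; linarith) fun C _ _ => hM.inK.2 C
  have hjp : (j + 1) * p ≤ J * p := Nat.mul_le_mul_right p hjJ
  have hjp' : (j + 1) * p = j * p + p := by ring
  obtain ⟨F, hF, hFa⟩ := haa'.exists_partialIso (C := A) hXA (by rw [← hX]; omega)
  have hFX : X.image F = X' := by
    rw [hX, Finset.image_image, hX']
    exact Finset.image_congr fun i _ => hFa i
  have hX'card : X'.card = X.card := by
    rw [← hFX, Finset.card_image_of_injOn (hF.mono hXA).1]
  have hFAcard : (A.image F).card = A.card := Finset.card_image_of_injOn hF.1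
  have hX'A : X' ⊆ A.image F := by
    rw [← hFX]
    exact Finset.image_subset_image hXA
  have hA : StrongUpTo α E p A := fun C hAC hC =>
    hgap' E A C hAC hC (hAmin C (hXA.trans hAC) (by omega))
  -- A set over the copy of `A` is pulled back over `a` by `G`. The result contains `X` but perhaps
  -- not `A`, which is why `A` was chosen nearly minimal among all supersets of `X` of the given
  -- size.
  have hA' : StrongUpTo α E p (A.image F) := by
    intro C hAC hC
    obtain ⟨G, hG, hGa⟩ := ha'a.exists_partialIso (C := C) (hX'A.trans hAC) (by rw [← hX']; omega)
    refine hgap' E _ C hAC hC ?_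
    rw [hF.delta_image, ← hG.delta_image]
    refine hAmin _ ?_ ?_
    · intro x hx
      obtain ⟨i, -, rfl⟩ := Finset.mem_image.1 hx
      rw [← hGa i]
      exact Finset.mem_image_of_mem G (hAC (hX'A (Finset.mem_image_of_mem a' (Finset.mem_univ i))))
    · rw [Finset.card_image_of_injOn hG.1]
      omega
  have hbA : (insert b A).card ≤ A.card + 1 := Finset.card_insert_le b A
  -- This descent starts at most `1` above `δ(A)` and cannot fall below `δ(A)`, as `A` is strong up
  -- to `p`; hence `I > 1 / ε` rounds suffice.
  obtain ⟨i, hiI, B, hbB, hBcard, hBmin⟩ := exists_almost_minimal (α := α) E (insert b A) (ε := ε)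
    (l := delta α E A) (p := m) (I := I)
    (by have := delta_insert_le hα E A b; linarith)
    fun C hC hCc => hA C ((Finset.subset_insert b A).trans hC) (by omega)
  have hAB : A ⊆ B := (Finset.subset_insert b A).trans hbB
  have him : i * m ≤ I * m := Nat.mul_le_mul_right m hiI.le
  have him' : (i + 1) * m = i * m + m := by ring
  have hB : StrongUpTo α E m B := fun C hBC hC =>
    hgap E B C hBC hC (hBmin C (hbB.trans hBC) (by omega))
  have hABs : StrongIn α E A (B : Set M) := fun C hAC hCB =>
    hA C hAC (by have := Finset.card_le_card (show C ⊆ B by exact_mod_cast hCB); omega)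
  -- The copy of `A` is only strong up to `p`, so `B` is amalgamated with a strong hull of that
  -- copy.
  obtain ⟨D, hAD, hD⟩ := hM.exists_strong_superset hα (A.image F)
  obtain ⟨g, hg, hgF, hgD, hgs, hfree⟩ := hM.exists_free_extension hα hAB hABs hF hAD hD
  have hgA : A.image g = A.image F := Finset.image_congr fun x hx => hgF x hx
  have hDB : D ∩ B.image g = A.image F := by
    ext x
    rw [Finset.mem_inter]
    constructor
    · rintro ⟨h1, h2⟩
      obtain ⟨y, hy, rfl⟩ := Finset.mem_image.1 h2
      rw [← hgA]
      exact Finset.mem_image_of_mem g (hgD y hy h1)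
    · intro hx
      refine ⟨hAD hx, ?_⟩
      rw [← hgA] at hx
      exact Finset.image_subset_image hAB hx
  have hB' : StrongUpTo α E m (B.image g) :=
    strongUpTo_of_free hα (fun C h1 h2 => hA' C h1 (by omega)) hDB hgs hfree
  have hab : ∀ i, Sum.elim a (fun _ : Unit => b) i ∈ B := by
    rintro (i | i)
    · exact hAB (hXA (Finset.mem_image_of_mem a (Finset.mem_univ i)))
    · exact hbB (Finset.mem_insert_self b A)
  have hgab : g ∘ Sum.elim a (fun _ : Unit => b) = Sum.elim a' (fun _ : Unit => g b) := by
    rw [Sum.comp_elim]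
    congr 1
    funext i
    rw [Function.comp_apply, hgF _ (hXA (Finset.mem_image_of_mem a (Finset.mem_univ i))), hFa]
  refine ⟨g b, ?_, ?_⟩
  · rw [← hgab]
    exact hM.existsLE_of_strongUpTo hα hB hg hab
  -- The image of `B` is also strong up to `m`, so the inverse of `g` gives the reverse comparison.
  · have := hM.existsLE_of_strongUpTo hα hB' hg.invFunOn
      (a := g ∘ Sum.elim a (fun _ : Unit => b)) fun i => Finset.mem_image_of_mem g (hab i)
    rw [hgab] at this
    convert this using 1
    rw [← hgab]
    funext i
    exact (hg.1.leftInvOn_invFunOn (hab i)).symm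

end Lookahead

/-! ### Invariance of formulas under existential types. -/

section Invariance

variable {L : FirstOrder.Language.{u, v}} [L.IsRelational] {M : Type w} [L.Structure M]

lemma exists_eq_var {β : Type} (t : L.Term β) : ∃ i, t = Term.var i := by
  cases t with
  | var i => exact ⟨i, rfl⟩
  | func f _ => exact isEmptyElim f

variable [Fintype (Σ n, L.Relations n)] {α : (Σ n, L.Relations n) → ℝ}

/-- Every formula is invariant under equality of existential types with sufficiently long blocks
of quantifiers. -/
lemma IsGeneric.exists_invariant [Nonempty M] (hα : ∀ R, 0 < α R) (hM : IsGeneric α M) {β : Type}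
    [Fintype β] {l : ℕ} (φ : L.BoundedFormula β l) : ∃ k, ∀ (v v' : β → M) (xs xs' : Fin l → M),
      ExistsLE L k (Sum.elim v xs) (Sum.elim v' xs') →
      ExistsLE L k (Sum.elim v' xs') (Sum.elim v xs) →
      (φ.Realize v xs ↔ φ.Realize v' xs') := by
  induction φ with
  | falsum => exact ⟨0, fun _ _ _ _ _ _ => Iff.rfl⟩
  | equal t₁ t₂ =>
    obtain ⟨i, rfl⟩ := exists_eq_var t₁
    obtain ⟨j, rfl⟩ := exists_eq_var t₂
    refine ⟨0, fun v v' xs xs' h _ => ?_⟩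
    simpa only [BoundedFormula.Realize, Term.realize_var] using h.qfEquiv.1 i j
  | rel R ts =>
    choose x hx using fun i => exists_eq_var (ts i)
    obtain rfl : ts = fun i => Term.var (x i) := funext hx
    refine ⟨0, fun v v' xs xs' h _ => ?_⟩
    exact h.qfEquiv.2 ⟨_, R⟩ x
  | imp φ ψ ihφ ihψ =>
    obtain ⟨k, hk⟩ := ihφ
    obtain ⟨k', hk'⟩ := ihψ
    refine ⟨max k k', fun v v' xs xs' h h' => ?_⟩
    rw [BoundedFormula.realize_imp, BoundedFormula.realize_imp,
      hk v v' xs xs' (h.mono (le_max_left k k')) (h'.mono (le_max_left k k')),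
      hk' v v' xs xs' (h.mono (le_max_right k k')) (h'.mono (le_max_right k k'))]
  | @all l φ ih =>
    obtain ⟨m, hm⟩ := ih
    obtain ⟨k, hk⟩ := hM.exists_lookahead hα (Fintype.card (β ⊕ Fin l)) m
    have key : ∀ (v v' : β → M) (xs xs' : Fin l → M),
        ExistsLE L k (Sum.elim v xs) (Sum.elim v' xs') →
        ExistsLE L k (Sum.elim v' xs') (Sum.elim v xs) →
        φ.all.Realize v xs → φ.all.Realize v' xs' := by
      intro v v' xs xs' h h' hall b
      -- The lookahead runs from the primed side: a test value `b` over `v'` is matched by `b'` over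
      -- `v`, where the universal formula is known.
      obtain ⟨b', h1, h2⟩ := hk _ le_rfl _ _ h' h b
      let e : β ⊕ Fin (l + 1) → (β ⊕ Fin l) ⊕ Unit := Sum.elim (fun i => Sum.inl (Sum.inl i))
        (Fin.snoc (fun i => Sum.inl (Sum.inr i)) (Sum.inr ()))
      have he : ∀ (v : β → M) (xs : Fin l → M) (b : M),
          Sum.elim v (Fin.snoc xs b) = Sum.elim (Sum.elim v xs) (fun _ : Unit => b) ∘ e := by
        intro v xs b
        funext i
        rcases i with i | i
        · rfl
        · refine Fin.lastCases ?_ (fun i => ?_) i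
          · simp [e]
          · simp [e]
      have h1' := h1.comp e
      have h2' := h2.comp e
      rw [← he, ← he] at h1' h2'
      exact (hm _ _ _ _ h2' h1').1 (hall b')
    exact ⟨k, fun v v' xs xs' h h' => ⟨key v v' xs xs' h h', key v' v xs' xs h' h⟩⟩

end Invariance

/-! ### From invariance to Boolean combinations of existential formulas. -/

section Definability

variable (L : FirstOrder.Language.{u, v}) {M : Type w} [L.Structure M]

/-- A relation between `β`-tuples and `k`-tuples is defined by a quantifier-free formula. -/
def QFDefinable {β : Type} {k : ℕ} (P : (β → M) → (Fin k → M) → Prop) : Prop :=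
  ∃ θ : L.BoundedFormula β k, θ.IsQF ∧ ∀ v xs, θ.Realize v xs ↔ P v xs

/-- A set of tuples is defined by a Boolean combination of `Σ₁`-formulas. -/
def BoolSigmaOneDefinable {β : Type} (P : (β → M) → Prop) : Prop :=
  ∃ ψ : L.Formula β, IsBoolCombSigmaOne ψ ∧ ∀ v, ψ.Realize v ↔ P v

variable {L}

lemma QFDefinable.iInf {β : Type} {k : ℕ} {κ : Type*} [Finite κ]
    {P : κ → (β → M) → (Fin k → M) → Prop} (h : ∀ i, QFDefinable L (P i)) :
    QFDefinable L fun v xs => ∀ i, P i v xs := by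
  classical
  have := Fintype.ofFinite κ
  have key : ∀ s : Finset κ, QFDefinable L fun v xs => ∀ i ∈ s, P i v xs := by
    intro s
    induction s using Finset.induction_on with
    | empty => exact ⟨⊤, BoundedFormula.IsQF.top, by simp⟩
    | insert i s _ ih =>
      obtain ⟨θ, hθ, h1⟩ := ih
      obtain ⟨θ', hθ', h2⟩ := h i
      exact ⟨θ' ⊓ θ, hθ'.inf hθ, fun v xs => by simp [h1, h2]⟩
  simpa using key Finset.univ

lemma QFDefinable.iff_prop {β : Type} {k : ℕ} {P : (β → M) → (Fin k → M) → Prop}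
    (h : QFDefinable L P) (p : Prop) : QFDefinable L fun v xs => P v xs ↔ p := by
  by_cases hp : p
  · simpa [hp] using h
  · obtain ⟨θ, hθ, h1⟩ := h
    exact ⟨θ.not, hθ.not, fun v xs => by simp [h1, hp]⟩

lemma QFDefinable.exists {β : Type} {k : ℕ} {P : (β → M) → (Fin k → M) → Prop}
    (h : QFDefinable L P) : BoolSigmaOneDefinable L fun v => ∃ xs, P v xs := by
  obtain ⟨θ, hθ, h1⟩ := h
  refine ⟨θ.exs, .sigmaOne ⟨k, θ, hθ, rfl⟩, fun v => ?_⟩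
  rw [BoundedFormula.realize_exs]
  simp [h1]

lemma BoolSigmaOneDefinable.iff_prop {β : Type} {P : (β → M) → Prop}
    (h : BoolSigmaOneDefinable L P) (p : Prop) : BoolSigmaOneDefinable L fun v => P v ↔ p := by
  by_cases hp : p
  · simpa [hp] using h
  · obtain ⟨θ, hθ, h1⟩ := h
    exact ⟨θ.not, hθ.not, fun v => by simp [h1, hp]⟩

lemma boolSigmaOneDefinable_const {β : Type} (p : Prop) :
    BoolSigmaOneDefinable L fun _ : β → M => p := by
  by_cases hp : p
  · exact ⟨⊤, .sigmaOne ⟨0, ⊤, BoundedFormula.IsQF.top, rfl⟩, by simp [hp]⟩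
  · exact ⟨⊥, .sigmaOne ⟨0, ⊥, BoundedFormula.IsQF.falsum, rfl⟩, by simp [hp]⟩

lemma BoolSigmaOneDefinable.iInf {β : Type} {κ : Type*} [Finite κ] {P : κ → (β → M) → Prop}
    (h : ∀ i, BoolSigmaOneDefinable L (P i)) : BoolSigmaOneDefinable L fun v => ∀ i, P i v := by
  classical
  have := Fintype.ofFinite κ
  have key : ∀ s : Finset κ, BoolSigmaOneDefinable L fun v => ∀ i ∈ s, P i v := by
    intro s
    induction s using Finset.induction_on with
    | empty => simpa using boolSigmaOneDefinable_const True
    | insert i s _ ih =>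
      obtain ⟨θ, hθ, h1⟩ := ih
      obtain ⟨θ', hθ', h2⟩ := h i
      exact ⟨θ' ⊓ θ, hθ'.inf hθ, fun v => by simp [h1, h2]⟩
  simpa using key Finset.univ

lemma BoolSigmaOneDefinable.iSup {β : Type} {κ : Type*} [Finite κ] {P : κ → (β → M) → Prop}
    (h : ∀ i, BoolSigmaOneDefinable L (P i)) : BoolSigmaOneDefinable L fun v => ∃ i, P i v := by
  have := (BoolSigmaOneDefinable.iInf fun i => (h i).iff_prop False).iff_prop False
  simpa using this

/-- Invariants of quantifier-free types of tuples: which equalities and which relations hold. -/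
abbrev QFType (L : FirstOrder.Language.{u, v}) (γ : Type) : Type v :=
  (γ → γ → Prop) × ((R : Σ n, L.Relations n) → (Fin R.1 → γ) → Prop)

variable (L) in
/-- The quantifier-free type of a tuple. -/
def qfType {γ : Type} (a : γ → M) : QFType L γ :=
  (fun i j => a i = a j, fun R x => Structure.RelMap R.2 (a ∘ x))

lemma qfEquiv_iff {γ : Type} {a a' : γ → M} : QFEquiv L a a' ↔ qfType L a = qfType L a' := by
  simp only [QFEquiv, qfType, Prod.mk.injEq, funext_iff, eq_iff_iff]

lemma qfDefinable_eq {β : Type} {k : ℕ} (i j : β ⊕ Fin k) :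
    QFDefinable L fun (v : β → M) xs => Sum.elim v xs i = Sum.elim v xs j :=
  ⟨(Term.var i).bdEqual (Term.var j), (BoundedFormula.IsAtomic.equal _ _).isQF, fun v xs => by
    simp [BoundedFormula.realize_bdEqual]⟩

lemma qfDefinable_rel {β : Type} {k : ℕ} (R : Σ n, L.Relations n) (x : Fin R.1 → β ⊕ Fin k) :
    QFDefinable L fun (v : β → M) xs => Structure.RelMap R.2 (Sum.elim v xs ∘ x) :=
  ⟨R.2.boundedFormula fun i => Term.var (x i), (BoundedFormula.IsAtomic.rel _ _).isQF,
    fun v xs => by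
      rw [BoundedFormula.realize_rel]
      rfl⟩

variable [Fintype (Σ n, L.Relations n)]

lemma qfDefinable_qfType {β : Type} [Finite β] {k : ℕ} (t : QFType L (β ⊕ Fin k)) :
    QFDefinable L fun (v : β → M) xs => qfType L (Sum.elim v xs) = t := by
  have h1 : QFDefinable L fun (v : β → M) xs => ∀ i j,
      (Sum.elim v xs i = Sum.elim v xs j ↔ t.1 i j) :=
    QFDefinable.iInf fun i => QFDefinable.iInf fun j => (qfDefinable_eq i j).iff_prop _
  have h2 : QFDefinable L fun (v : β → M) xs => ∀ R x,
      (Structure.RelMap R.2 (Sum.elim v xs ∘ x) ↔ t.2 R x) :=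
    QFDefinable.iInf fun R => QFDefinable.iInf fun x => (qfDefinable_rel R x).iff_prop _
  obtain ⟨θ, hθ, h1⟩ := h1
  obtain ⟨θ', hθ', h2⟩ := h2
  refine ⟨θ ⊓ θ', hθ.inf hθ', fun v xs => ?_⟩
  rw [BoundedFormula.realize_inf, h1, h2]
  simp only [qfType, Prod.ext_iff, funext_iff, eq_iff_iff]

/-- A set of tuples that is invariant under equality of existential types with blocks of `k`
quantifiers is defined by a Boolean combination of `Σ₁`-formulas. -/
lemma boolSigmaOneDefinable_of_invariant {β : Type} [Finite β] (k : ℕ) (P : (β → M) → Prop)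
    (hP : ∀ v v', ExistsLE L k v v' → ExistsLE L k v' v → P v → P v') :
    BoolSigmaOneDefinable L P := by
  let T : (β → M) → QFType L (β ⊕ Fin k) → Prop := fun v t =>
    ∃ xs : Fin k → M, qfType L (Sum.elim v xs) = t
  have hT : ∀ v v', (∀ t, T v t → T v' t) → ExistsLE L k v v' := fun v v' h c => by
    obtain ⟨c', hc'⟩ := h _ ⟨c, rfl⟩
    exact ⟨c', qfEquiv_iff.2 hc'.symm⟩
  -- The set is a union of classes indexed by the sets of quantifier-free types realized over its
  -- members. There are finitely many such types, so the disjunction over `s` and the conjunction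
  -- over `t` are finite.
  have hdef : BoolSigmaOneDefinable L fun v : β → M =>
      ∃ s : {s : QFType L (β ⊕ Fin k) → Prop // ∃ v, P v ∧ T v = s}, ∀ t, (T v t ↔ s.1 t) :=
    BoolSigmaOneDefinable.iSup fun s => BoolSigmaOneDefinable.iInf fun t =>
      (qfDefinable_qfType t).exists.iff_prop _
  convert hdef using 2 with v
  refine ⟨fun hv => ⟨⟨T v, v, hv, rfl⟩, fun t => Iff.rfl⟩, ?_⟩
  rintro ⟨⟨_, v', hv', rfl⟩, hs⟩
  exact hP v' v (hT _ _ fun t => (hs t).2) (hT _ _ fun t => (hs t).1) hv'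

end Definability

/-! ### Near model completeness of the theory. -/

section NearModelCompleteness

variable {L : FirstOrder.Language.{u, v}} {M : Type w} [L.Structure M]

lemma iff_completeTheory_of_realize {n : ℕ} {φ ψ : L.Formula (Fin n)}
    (h : ∀ v : Fin n → M, φ.Realize v ↔ ψ.Realize v) : φ ⇔[L.completeTheory M] ψ := by
  let σ : L.Sentence := Formula.iAlls (Fin n) ((φ.iff ψ).relabel (Sum.inr : Fin n → Empty ⊕ Fin n))
  have hσ : ∀ (N : Type (max u v)) [L.Structure N], N ⊨ σ ↔
      ∀ v : Fin n → N, φ.Realize v ↔ ψ.Realize v := by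
    intro N _
    simp only [σ, Sentence.Realize, Formula.realize_iAlls, Formula.realize_relabel]
    simp [Formula.realize_iff]
  have hσM : M ⊨ σ := by
    simp only [σ, Sentence.Realize, Formula.realize_iAlls, Formula.realize_relabel]
    simpa [Formula.realize_iff] using h
  intro N v xs
  have hN : (N : Type (max u v)) ⊨ σ :=
    Theory.realize_sentence_of_mem (L.completeTheory M) hσM
  obtain rfl : xs = default := Subsingleton.elim _ _
  exact BoundedFormula.realize_iff.2 ((hσ N).1 hN v)

theorem IsGeneric.nearlyModelComplete [L.IsRelational] [Fintype (Σ n, L.Relations n)]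
    {α : (Σ n, L.Relations n) → ℝ} (hα : ∀ R, 0 < α R) (hM : IsGeneric α M) :
    NearlyModelComplete (L.completeTheory M) := by
  intro n φ
  obtain ⟨k, hk⟩ : ∃ k, ∀ v v' : Fin n → M, ExistsLE L k v v' → ExistsLE L k v' v →
      φ.Realize v → φ.Realize v' := by
    rcases isEmpty_or_nonempty M with hE | hE
    -- Over an empty universe there is at most one `n`-tuple.
    · refine ⟨0, fun v v' _ _ h => ?_⟩
      rwa [← Subsingleton.elim v v']
    · obtain ⟨k, hk⟩ := hM.exists_invariant hα φ
      refine ⟨k, fun v v' h h' => (hk v v' default default ?_ ?_).1⟩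
      · convert h.comp (Sum.elim id Fin.elim0) using 1 <;>
        · funext i
          rcases i with i | i
          · rfl
          · exact i.elim0
      · convert h'.comp (Sum.elim id Fin.elim0) using 1 <;>
        · funext i
          rcases i with i | i
          · rfl
          · exact i.elim0
  obtain ⟨ψ, hψ, h⟩ := boolSigmaOneDefinable_of_invariant k _ hk
  exact ⟨ψ, hψ, iff_completeTheory_of_realize fun v => (h v).symm⟩

end NearModelCompleteness

/-! ### Construction of a generic model. -/

section Existence

lemma StrongIn.congr {ι V : Type*} [Fintype ι] {α : ι → ℝ} {H H' : ι → Set (Finset V)}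
    {A T : Finset V} (hAT : A ⊆ T) (hHH' : ∀ R, ∀ S ⊆ T, S ∈ H' R ↔ S ∈ H R)
    (h : StrongIn α H A (T : Set V)) : StrongIn α H' A (T : Set V) := by
  intro C hAC hCT
  have hCT' : C ⊆ T := by exact_mod_cast hCT
  rw [delta_congr fun R S hS => hHH' R S (hS.trans hAT),
    delta_congr fun R S hS => hHH' R S (hS.trans hCT')]
  exact h C hAC hCT

lemma StrongIn.of_edges_subset {ι V : Type*} [Fintype ι] [DecidableEq V] {α : ι → ℝ}
    {H : ι → Set (Finset V)} {A Q : Finset V} (hAQ : A ⊆ Q) (hQ : ∀ R, ∀ S ∈ H R, S ⊆ Q)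
    (h : StrongIn α H A (Q : Set V)) (T : Set V) : StrongIn α H A T := fun C hAC _ =>
  (h (C ∩ Q) (Finset.subset_inter hAC hAQ) (by simp)).trans (delta_inter_le_of_edges_subset hQ C)

variable {L : FirstOrder.Language.{u, v}} [Fintype (Σ n, L.Relations n)]

/-- A finite approximation of the generic model: a member of `K_α` with universe
`{0, …, size - 1}`. -/
structure Approximation (α : (Σ n, L.Relations n) → ℝ) where
  /-- The number of elements. -/
  size : ℕ
  /-- The hypergraph. -/
  hyp : (Σ n, L.Relations n) → Set (Finset ℕ)
  subset_range : ∀ R, ∀ S ∈ hyp R, S ⊆ Finset.range size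
  card_eq : ∀ R, ∀ S ∈ hyp R, S.card = R.1
  nonneg : ∀ Y, 0 ≤ delta α hyp Y

variable {α : (Σ n, L.Relations n) → ℝ}

/-- Approximations are ordered by being a strong substructure. -/
@[reducible] def approximationPreorder (hα : ∀ R, 0 < α R) : Preorder (Approximation α) where
  le p q := p.size ≤ q.size ∧ (∀ R, ∀ S ⊆ Finset.range p.size, S ∈ q.hyp R ↔ S ∈ p.hyp R) ∧
    StrongIn α q.hyp (Finset.range p.size) (Finset.range q.size : Set ℕ)
  le_refl p := ⟨le_rfl, fun _ _ _ => Iff.rfl, fun C h1 h2 => by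
    rw [subset_antisymm h1 (by exact_mod_cast h2)]⟩
  le_trans p q r := by
    rintro ⟨h1, h2, h3⟩ ⟨h1', h2', h3'⟩
    have hpq : Finset.range p.size ⊆ Finset.range q.size := Finset.range_subset_range.2 h1
    refine ⟨h1.trans h1', fun R S hS => (h2' R S (hS.trans hpq)).trans (h2 R S hS), ?_⟩
    exact StrongIn.trans hα hpq (by exact_mod_cast Finset.range_subset_range.2 h1')
      (h3.congr hpq h2') h3'

namespace Approximation

lemma exists_ge_size (hα : ∀ R, 0 < α R) (p : Approximation α) {N : ℕ} (hN : p.size ≤ N) :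
    ∃ q, (approximationPreorder hα).le p q ∧ q.size = N := by
  have hsub := Finset.range_subset_range.2 hN
  refine ⟨⟨N, p.hyp, fun R S hS => (p.subset_range R S hS).trans hsub, p.card_eq, p.nonneg⟩,
    ⟨hN, fun _ _ _ => Iff.rfl, StrongIn.of_edges_subset subset_rfl p.subset_range ?_ _⟩, rfl⟩
  intro C h1 h2
  rw [subset_antisymm h1 (by exact_mod_cast h2)]

/-- The strong embedding `f` of `A` extends to one of the whole finite hypergraph `E`. -/
def Realizes (p : Approximation α) {k : ℕ} (E : (Σ n, L.Relations n) → Set (Finset (Fin k)))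
    (A : Finset (Fin k)) (f : Fin k → ℕ) : Prop :=
  ∃ g : Fin k → ℕ, PartialIso E p.hyp g Finset.univ ∧ (∀ b, g b < p.size) ∧
    (∀ a ∈ A, g a = f a) ∧
    StrongIn α p.hyp (Finset.univ.image g) (Finset.range p.size : Set ℕ)

/-- In the free amalgam both factors are strong, because the common part is strong in each: strength
of `P` makes the amalgam a later approximation, and strength of the copy of `E` is the realization
sought. -/
lemma exists_ge_realizes (hα : ∀ R, 0 < α R) (p : Approximation α) {k : ℕ}
    {E : (Σ n, L.Relations n) → Set (Finset (Fin k))} (hE : ∀ R, ∀ S ∈ E R, S.card = R.1)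
    {A : Finset (Fin k)} (hA : StrongIn α E A Set.univ) {f : Fin k → ℕ}
    (hf : PartialIso E p.hyp f A) (hfp : ∀ a, f a < p.size)
    (hfs : StrongIn α p.hyp (A.image f) (Finset.range p.size : Set ℕ)) :
    ∃ q, (approximationPreorder hα).le p q ∧ q.Realizes E A f := by
  set P := Finset.range p.size with hP
  obtain ⟨H', g, hg, hgf, hgP, hH'P, hH'⟩ := exists_free_amalgam (B := Finset.univ) (P := P) hf
    fun a _ => Finset.mem_range.2 (hfp a)
  set B := Finset.univ.image g with hB
  have hfree : ∀ R, ∀ S ∈ H' R, S ⊆ P ∨ S ⊆ B := by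
    intro R S hS
    rcases hH' R S hS with h | ⟨T, hT, -, rfl⟩
    · exact Or.inl h.1
    · exact Or.inr (Finset.image_subset_image hT)
  have hQ : ∀ R, ∀ S ∈ H' R, S ⊆ P ∪ B := fun R S hS => (hfree R S hS).elim
    (fun h => h.trans Finset.subset_union_left) fun h => h.trans Finset.subset_union_right
  have hAP : A.image f ⊆ P := fun x hx => by
    obtain ⟨a, -, rfl⟩ := Finset.mem_image.1 hx
    exact Finset.mem_range.2 (hfp a)
  have hgA : A.image g = A.image f := Finset.image_congr fun a ha => hgf a ha
  have hinter : P ∩ B = A.image f := by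
    ext x
    rw [Finset.mem_inter]
    constructor
    · rintro ⟨h1, h2⟩
      obtain ⟨b, hb, rfl⟩ := Finset.mem_image.1 h2
      rw [← hgA]
      exact Finset.mem_image_of_mem g (hgP b hb h1)
    · intro hx
      refine ⟨hAP hx, ?_⟩
      rw [← hgA] at hx
      exact Finset.image_subset_image (Finset.subset_univ A) hx
  have hsB : StrongIn α H' (P ∩ B) (B : Set ℕ) := by
    rw [hinter, ← hgA]
    exact hg.strongIn_image (Finset.subset_univ A) (by simpa using hA)
  have hsP : StrongIn α H' (B ∩ P) (P : Set ℕ) := by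
    rw [Finset.inter_comm, hinter]
    exact hfs.congr hAP hH'P
  -- The universe must be an initial segment; the points below `N` outside `P ∪ B` are isolated and
  -- harmless.
  obtain ⟨N, hN⟩ := (P ∪ B).exists_nat_subset_range
  have hBN : B ⊆ Finset.range N := Finset.subset_union_right.trans hN
  refine ⟨⟨N, H', fun R S hS => (hQ R S hS).trans hN, fun R S hS => ?_, fun Y => ?_⟩,
    ⟨?_, hH'P, ?_⟩, g, hg, fun b => ?_, hgf, ?_⟩
  · rcases hH' R S hS with h | ⟨T, hT, hTE, rfl⟩
    · exact p.card_eq R S h.2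
    · rw [Finset.card_image_of_injOn (hg.mono hT).1, hE R T hTE]
  · refine le_trans ?_ (delta_inter_le_of_edges_subset hQ Y)
    refine free_join_nonneg hα (fun R S hS _ => hfree R S hS) hsB (fun Z hZ => ?_)
      Finset.inter_subset_right
    rw [delta_congr fun R S hS => hH'P R S (hS.trans hZ)]
    exact p.nonneg Z
  · exact Finset.range_subset_range.1 (Finset.subset_union_left.trans hN)
  · exact StrongIn.of_edges_subset Finset.subset_union_left hQ
      (free_join_strong (fun R S hS _ => hfree R S hS) hsB) _
  · exact Finset.mem_range.1 (hBN (Finset.mem_image_of_mem g (Finset.mem_univ b)))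
  · refine StrongIn.of_edges_subset Finset.subset_union_right hQ ?_ _
    rw [Finset.union_comm]
    exact free_join_strong (fun R S hS _ => (hfree R S hS).symm) hsP

/-- The requirement that a given strong extension be realized, if it ever makes sense. -/
def Meets (p : Approximation α) {k : ℕ} (E : (Σ n, L.Relations n) → Set (Finset (Fin k)))
    (A : Finset (Fin k)) (f : Fin k → ℕ) : Prop :=
  (∀ a, f a < p.size) ∧ ((∀ R, ∀ S ∈ E R, S.card = R.1) → StrongIn α E A Set.univ →
    PartialIso E p.hyp f A → StrongIn α p.hyp (A.image f) (Finset.range p.size : Set ℕ) →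
    p.Realizes E A f)

lemma exists_ge_meets (hα : ∀ R, 0 < α R) (p : Approximation α) {k : ℕ}
    (E : (Σ n, L.Relations n) → Set (Finset (Fin k))) (A : Finset (Fin k)) (f : Fin k → ℕ) :
    ∃ q, (approximationPreorder hα).le p q ∧ q.Meets E A f := by
  let _ := approximationPreorder hα
  obtain ⟨q, hpq, hq⟩ := p.exists_ge_size hα (Nat.le_add_right p.size (Finset.univ.sup f + 1))
  have hfq : ∀ a, f a < q.size := fun a => by
    have := Finset.le_sup (f := f) (Finset.mem_univ a)
    omega
  by_cases h : (∀ R, ∀ S ∈ E R, S.card = R.1) ∧ StrongIn α E A Set.univ ∧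
      PartialIso E q.hyp f A ∧ StrongIn α q.hyp (A.image f) (Finset.range q.size : Set ℕ)
  · obtain ⟨r, hqr, hr⟩ := q.exists_ge_realizes hα h.1 h.2.1 h.2.2.1 hfq h.2.2.2
    exact ⟨r, le_trans hpq hqr, fun a => (hfq a).trans_le hqr.1, fun _ _ _ _ => hr⟩
  · exact ⟨q, hpq, hfq, fun h1 h2 h3 h4 => absurd ⟨h1, h2, h3, h4⟩ h⟩

/-- There is an increasing sequence of approximations that meets all requirements. -/
lemma exists_sequence (hα : ∀ R, 0 < α R) : ∃ p : ℕ → Approximation α,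
    (∀ i j, i ≤ j → (approximationPreorder hα).le (p i) (p j)) ∧
    ∀ (k : ℕ) (E : (Σ n, L.Relations n) → Set (Finset (Fin k))) (A : Finset (Fin k))
      (f : Fin k → ℕ), ∃ i, (p i).Meets E A f := by
  let _ := approximationPreorder hα
  -- There are countably many requirements, each cofinal among the approximations, so a single
  -- increasing sequence meets them all.
  let τ := Σ k : ℕ, ((Σ n, L.Relations n) → Set (Finset (Fin k))) × Finset (Fin k) × (Fin k → ℕ)
  let _ : Encodable τ := Encodable.ofCountable τ
  let p₀ : Approximation α := ⟨0, fun _ => ∅, by simp, by simp, fun Y => by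
    simp [delta, edgeCount]⟩
  let 𝒟 : τ → Order.Cofinal (Approximation α) := fun t =>
    ⟨{p | p.Meets t.2.1 t.2.2.1 t.2.2.2}, fun p => by
      obtain ⟨q, hpq, hq⟩ := p.exists_ge_meets hα t.2.1 t.2.2.1 t.2.2.2
      exact ⟨q, hq, hpq⟩⟩
  exact ⟨Order.sequenceOfCofinals p₀ 𝒟, fun i j hij =>
    Order.sequenceOfCofinals.monotone p₀ 𝒟 hij, fun k E A f =>
    ⟨_, Order.sequenceOfCofinals.encode_mem p₀ 𝒟 ⟨k, E, A, f⟩⟩⟩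

end Approximation

theorem exists_isGeneric [L.IsRelational] (hα : ∀ R, 0 < α R) :
    ∃ (M : Type) (_ : L.Structure M), IsGeneric α M := by
  classical
  obtain ⟨p, hmono, hmeets⟩ := Approximation.exists_sequence hα
  let H : (Σ n, L.Relations n) → Set (Finset ℕ) := fun R => ⋃ i, (p i).hyp R
  have hH : ∀ i R, ∀ S ⊆ Finset.range (p i).size, S ∈ H R ↔ S ∈ (p i).hyp R := by
    intro i R S hS
    refine ⟨fun h => ?_, fun h => Set.mem_iUnion.2 ⟨i, h⟩⟩
    obtain ⟨j, hj⟩ := Set.mem_iUnion.1 h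
    rcases le_total i j with hij | hij
    · exact ((hmono i j hij).2.1 R S hS).1 hj
    · exact ((hmono j i hij).2.1 R S ((p j).subset_range R S hj)).2 hj
  have hcard : ∀ R, ∀ S ∈ H R, S.card = R.1 := fun R S hS => by
    obtain ⟨j, hj⟩ := Set.mem_iUnion.1 hS
    exact (p j).card_eq R S hj
  have hcov : ∀ C : Finset ℕ, ∃ i, C ⊆ Finset.range (p i).size := by
    intro C
    obtain ⟨N, hN⟩ := C.exists_nat_subset_range
    -- A dummy requirement with `f` constantly `N` is used only for its clause `N < (p i).size`.
    obtain ⟨i, hi, -⟩ := hmeets 1 (fun _ => ∅) ∅ fun _ => N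
    exact ⟨i, hN.trans (Finset.range_subset_range.2 (hi 0).le)⟩
  have hsub : ∀ i j, i ≤ j → Finset.range (p i).size ⊆ Finset.range (p j).size := fun i j hij =>
    Finset.range_subset_range.2 (hmono i j hij).1
  have hdelta : ∀ i, ∀ C ⊆ Finset.range (p i).size, delta α H C = delta α (p i).hyp C :=
    fun i C hC => delta_congr fun R S hS => hH i R S (hS.trans hC)
  have hstrong : ∀ i j, i ≤ j →
      StrongIn α H (Finset.range (p i).size) (Finset.range (p j).size : Set ℕ) := fun i j hij =>
    (hmono i j hij).2.2.congr (hsub i j hij) (hH j)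
  have hstrong' : ∀ i, StrongIn α H (Finset.range (p i).size) Set.univ := fun i C hC _ => by
    obtain ⟨j, hj⟩ := hcov C
    exact hstrong i (max i j) (le_max_left i j) C hC
      (by exact_mod_cast hj.trans (hsub j _ (le_max_right i j)))
  let _ : L.Structure ℕ := hypergraphStructure H
  have eH : edges L ℕ = H := edges_hypergraphStructure H hcard
  have hK : InK α ℕ := ⟨symmIrrefl_hypergraphStructure H, fun A => by
    obtain ⟨i, hi⟩ := hcov A
    rw [predim_eq_delta, eH, hdelta i A hi]
    exact (p i).nonneg A⟩
  refine ⟨ℕ, inferInstance, inferInstance, hK, ?_, fun i => Finset.range (p i).size,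
    fun i => ?_, ?_⟩
  · intro A B _ _ hA hB f h hf hh
    have := hA.1
    have := hB.1
    have := Fintype.ofFinite A
    have := Fintype.ofFinite B
    rw [strongEmb_iff hα hK.2, eH] at hf
    rw [strongEmb_iff hα hB.2.2] at hh
    obtain ⟨k, ⟨e⟩⟩ := Finite.exists_equiv_fin B
    let E : (Σ n, L.Relations n) → Set (Finset (Fin k)) := fun R =>
      {S | S.image e.symm ∈ edges L B R}
    have hEiso : ∀ C, PartialIso E (edges L B) e.symm C := fun C =>
      ⟨e.symm.injective.injOn, fun _ _ _ => Iff.rfl⟩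
    have hEcard : ∀ R, ∀ S ∈ E R, S.card = R.1 := fun R S hS => by
      rw [← card_of_mem_edges hB.2.1 hS, Finset.card_image_of_injective _ e.symm.injective]
    let A' : Finset (Fin k) := Finset.univ.image fun a => e (h a)
    have hA'im : A'.image e.symm = Finset.univ.image h := by
      simp only [A', Finset.image_image]
      exact Finset.image_congr fun a _ => by simp
    have hA' : StrongIn α E A' Set.univ := fun C hC _ => by
      rw [← (hEiso A').delta_image, ← (hEiso C).delta_image, hA'im]
      refine hh _ ?_ (Set.subset_univ _)
      rw [← hA'im]
      exact Finset.image_subset_image hC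
    have hinj : Function.Injective fun a => e (h a) := e.injective.comp h.injective
    -- The value `0` off the image of `A` plays no role, since only the restriction of `f'` to `A'`
    -- is compared with the realization.
    let f' : Fin k → ℕ := Function.extend (fun a => e (h a)) f fun _ => 0
    have hf' : ∀ a, f' (e (h a)) = f a := fun a => hinj.extend_apply f _ a
    have hf'im : ∀ S : Finset A, (S.image fun a => e (h a)).image f' = S.image f := fun S => by
      rw [Finset.image_image]
      exact Finset.image_congr fun a _ => hf' a
    have hf'iso : PartialIso E H f' A' := by
      refine ⟨fun x hx y hy hxy => ?_, fun R S hS => ?_⟩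
      · obtain ⟨a, -, rfl⟩ := Finset.mem_image.1 (Finset.mem_coe.1 hx)
        obtain ⟨b, -, rfl⟩ := Finset.mem_image.1 (Finset.mem_coe.1 hy)
        rw [hf', hf'] at hxy
        rw [f.injective hxy]
      · obtain ⟨T, -, rfl⟩ := Finset.subset_image_iff.1 hS
        rw [hf'im, ← eH, ← (partialIso_of_embedding f T).2 R T subset_rfl,
          (hEiso _).2 R _ subset_rfl, (partialIso_of_embedding h T).2 R T subset_rfl,
          Finset.image_image]
        congr! 2
        funext a
        simp
    have hf'A' : A'.image f' = Finset.univ.image f := hf'im _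
    obtain ⟨i, hi, hreal⟩ := hmeets k E A' f'
    have hA'i : A'.image f' ⊆ Finset.range (p i).size := fun x hx => by
      obtain ⟨a, -, rfl⟩ := Finset.mem_image.1 hx
      exact Finset.mem_range.2 (hi a)
    obtain ⟨g, hg, hgi, hgf, hgs⟩ := hreal hEcard hA'
      ⟨hf'iso.1, fun R S hS => (hf'iso.2 R S hS).trans
        (hH i R _ ((Finset.image_subset_image hS).trans hA'i))⟩
      (StrongIn.congr hA'i (fun R S hS => (hH i R S hS).symm) (by
        rw [hf'A']
        exact fun C hC _ => hf C hC (Set.subset_univ _)))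
    have hgsub : ∀ S : Finset (Fin k), S.image g ⊆ Finset.range (p i).size := fun S x hx => by
      obtain ⟨a, -, rfl⟩ := Finset.mem_image.1 hx
      exact Finset.mem_range.2 (hgi a)
    have hgH : PartialIso E H g Finset.univ :=
      ⟨hg.1, fun R S hS => (hg.2 R S hS).trans (hH i R _ (hgsub S)).symm⟩
    have heiso : ∀ C, PartialIso (edges L B) E e C := fun C => ⟨e.injective.injOn, fun R S _ => by
      rw [(hEiso _).2 R _ subset_rfl, Finset.image_image]
      simp⟩
    let g' : B ↪[L] ℕ := embeddingOfPartialIso hB.2.1 hK.1 (g ∘ e) fun C => by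
      rw [eH]
      exact (heiso C).comp (hgH.mono (Finset.subset_univ _))
    refine ⟨g', ?_, fun a => ?_⟩
    · rw [strongEmb_iff hα hK.2, eH]
      have : Finset.univ.image g' = Finset.univ.image g := by
        change Finset.univ.image (g ∘ e) = _
        rw [← Finset.image_image, Finset.image_univ_equiv]
      rw [this]
      -- The copy is strong in the stage `p i`, which is itself strong in the limit.
      exact StrongIn.trans hα (hgsub _) (Set.subset_univ _) (hgs.congr (hgsub _) (hH i))
        (hstrong' i)
    · change g (e (h a)) = f a
      rw [hgf _ (Finset.mem_image_of_mem _ (Finset.mem_univ a)), hf']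
  · rw [strong_coe_iff hα hK.2, eH]
    exact ⟨by exact_mod_cast hsub i (i + 1) (Nat.le_succ i), hstrong i (i + 1) (Nat.le_succ i)⟩
  · refine Set.eq_univ_of_forall fun n => ?_
    obtain ⟨i, hi⟩ := hcov {n}
    exact Set.mem_iUnion.2 ⟨i, hi (Finset.mem_singleton_self n)⟩

end Existence

end BaldwinShelah

/-- Let `L` be a finite relational language and `0 < α_R ≤ 1` for every relation symbol `R`. There
is a `(K_α, ≤_s)`-generic model, and the theory `T_α` of the generic model is nearly model
complete. -/
theorem mainTheorem7 (L : FirstOrder.Language.{u, v}) [L.IsRelational]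
    [Fintype (Σ n, L.Relations n)] (α : (Σ n, L.Relations n) → ℝ)
    (hα : ∀ R, 0 < α R ∧ α R ≤ 1) :
    (∃ (M : Type) (_ : L.Structure M), BaldwinShelah.IsGeneric α M) ∧
      ∀ (M : Type w) [L.Structure M], BaldwinShelah.IsGeneric α M →
        BaldwinShelah.NearlyModelComplete (L.completeTheory M) := by
  exact ⟨BaldwinShelah.exists_isGeneric fun R => (hα R).1, fun M _ hM =>
    hM.nearlyModelComplete fun R => (hα R).1⟩
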